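/- Let $n\ge 1$ and let $\mathbb H^n$ be the $n$-dimensional hyperbolic space of constant curvature $-1$ (with $\mathbb H^1=\mathbb R$). For a positive $C^2$ function $f$ on an open set $\Omega\subset\mathbb H^n$, call $f$ strictly $\lambda$-log-concave on $\Omega$ if at every point of $\Omega$ the matrix \[\bigl(-(\log f)_{ij}-\lambda\,|\nabla\log f|\,\delta_{ij}\bigr)\] is positive definite, where $(\log f)_{ij}$ are the components of the Riemannian Hessian of $\log f$ in an orthonormal frame. The first Dirichlet eigenfunction of a bounded domain $\Omega$ is a function $v\in C^2(\Omega)\cap C^0(\overline\Omega)$ with $v>0$ in $\Omega$, $v=0$ on $\partial\Omega$ and $\Delta v=-\mu_1 v$ in $\Omega$, where $\Delta$ is the Laplace--Beltrami operator and $\mu_1$ is the smallest Dirichlet eigenvalue of $-\Delta$ on $\Omega$. Then there exists a constant $r_0=r_0(n)>0$, depending only on $n$, such that for every geodesic ball $B_r\subset\mathbb H^n$ of radius $0<r<r_0$ the first Dirichlet eigenfunction of $B_r$ is strictly $1$-log-concave on $B_r$. -/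

import Mathlib

noncomputable section

namespace HypBall

/-- Minkowski space `ℝ^{1,n}`, the time coordinate first. -/
abbrev Mink (n : ℕ) : Type := ℝ × EuclideanSpace ℝ (Fin n)

/-- The Lorentzian inner product `-x₀ y₀ + x₁ y₁ + ⋯ + xₙ yₙ`. -/
def mink {n : ℕ} (x y : Mink n) : ℝ := inner ℝ x.2 y.2 - x.1 * y.1

/-- Hyperbolic space `ℍⁿ` (constant sectional curvature `-1`), as the upper sheet of the
hyperboloid `⟨x, x⟩ = -1` in Minkowski space. -/
def Hyp (n : ℕ) : Type := {x : Mink n // mink x x = -1 ∧ 0 < x.1}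

instance (n : ℕ) : TopologicalSpace (Hyp n) :=
  inferInstanceAs (TopologicalSpace {x : Mink n // mink x x = -1 ∧ 0 < x.1})

/-- The hyperbolic distance, `cosh d(x, y) = -⟨x, y⟩`. -/
def hdist {n : ℕ} (x y : Hyp n) : ℝ := Real.arcosh (-mink x.1 y.1)

/-- The open geodesic ball with centre `p` and radius `r`. -/
def geodesicBall {n : ℕ} (p : Hyp n) (r : ℝ) : Set (Hyp n) := {x | hdist p x < r}

/-- The tangent space of `ℍⁿ` at `x`: the Lorentz-orthogonal complement of `x`. The Riemannian
metric is the restriction of `mink` to it. -/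
def tangentSpace {n : ℕ} (x : Hyp n) : Submodule ℝ (Mink n) where
  carrier := {X | mink x.1 X = 0}
  add_mem' := by
    intro a b ha hb
    change inner ℝ x.1.2 a.2 - x.1.1 * a.1 = 0 at ha
    change inner ℝ x.1.2 b.2 - x.1.1 * b.1 = 0 at hb
    change inner ℝ x.1.2 (a.2 + b.2) - x.1.1 * (a.1 + b.1) = 0
    rw [inner_add_right]
    linarith
  zero_mem' := by
    change mink x.1 0 = 0
    simp [mink]
  smul_mem' := by
    intro c a ha
    change inner ℝ x.1.2 a.2 - x.1.1 * a.1 = 0 at ha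
    change inner ℝ x.1.2 (c • a.2) - x.1.1 * (c * a.1) = 0
    rw [inner_smul_right]
    linear_combination c * ha

/-- The Riemannian length of a tangent vector. -/
def tlen {n : ℕ} {x : Hyp n} (X : tangentSpace x) : ℝ := Real.sqrt (mink X.1 X.1)

theorem tangent_bound {n : ℕ} {x : Hyp n} (X : tangentSpace x) :
    X.1.1 ^ 2 ≤ mink X.1 X.1 * (x.1.1 ^ 2 - 1) ∧ 1 ≤ x.1.1 ^ 2 := by
  obtain ⟨⟨a, u⟩, hx, ha⟩ := x
  obtain ⟨⟨b, w⟩, hX⟩ := X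
  change inner ℝ u w - a * b = 0 at hX
  simp only [mink, real_inner_self_eq_norm_sq] at hx ha ⊢
  have h := real_inner_mul_inner_self_le u w
  simp only [real_inner_self_eq_norm_sq] at h
  have h1 : inner ℝ u w = a * b := by linarith
  rw [h1] at h
  have h2 : ‖u‖ ^ 2 = a ^ 2 - 1 := by linarith
  rw [h2] at h
  exact ⟨by nlinarith, by nlinarith [sq_nonneg ‖u‖]⟩

theorem mink_tangent_nonneg {n : ℕ} {x : Hyp n} (X : tangentSpace x) : 0 ≤ mink X.1 X.1 := by
  obtain ⟨h, h'⟩ := tangent_bound X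
  by_contra hneg
  push Not at hneg
  have hb : X.1.1 = 0 := by nlinarith [sq_nonneg X.1.1]
  simp only [mink, hb, real_inner_self_eq_norm_sq] at hneg
  nlinarith [sq_nonneg ‖X.1.2‖]

theorem exp_mem {n : ℕ} {x : Hyp n} (X : tangentSpace x) :
    mink (Real.cosh (tlen X) • x.1 + (Real.sinh (tlen X) / tlen X) • X.1)
        (Real.cosh (tlen X) • x.1 + (Real.sinh (tlen X) / tlen X) • X.1) = -1 ∧
      0 < (Real.cosh (tlen X) • x.1 + (Real.sinh (tlen X) / tlen X) • X.1).1 := by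
  have hs : tlen X ^ 2 = mink X.1 X.1 := Real.sq_sqrt (mink_tangent_nonneg X)
  have hs0 : 0 ≤ tlen X := Real.sqrt_nonneg _
  obtain ⟨h, h'⟩ := tangent_bound X
  generalize tlen X = s at *
  obtain ⟨⟨a, u⟩, hx, ha⟩ := x
  obtain ⟨⟨b, w⟩, hX⟩ := X
  change inner ℝ u w - a * b = 0 at hX
  simp only [mink] at hx ha hs h h' ⊢
  have hcs := Real.cosh_sq s
  simp only [Prod.smul_mk, Prod.mk_add_mk, smul_eq_mul, inner_add_left, inner_add_right,
    inner_smul_left, inner_smul_right, real_inner_comm u w, conj_trivial]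
  rcases hs0.eq_or_lt with h0 | h0
  · subst h0
    rw [real_inner_self_eq_norm_sq] at hx
    simp
    exact ⟨hx, ha⟩
  · set k := Real.sinh s / s with hk
    have hks : k * s = Real.sinh s := by rw [hk]; field_simp
    have hk0 : 0 < k := div_pos (Real.sinh_pos_iff.2 h0) h0
    constructor
    · have : k ^ 2 * s ^ 2 = Real.sinh s ^ 2 := by rw [← hks]; ring
      linear_combination (Real.cosh s) ^ 2 * hx + 2 * k * Real.cosh s * hX - k ^ 2 * hs
        - hcs + this
    · have hb : |b| ≤ s * a := by
        apply abs_le_of_sq_le_sq _ (by positivity)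
        nlinarith
      have h1 : k * |b| ≤ Real.sinh s * a := by
        rw [← hks]
        nlinarith
      have h2 : -|b| ≤ b := neg_abs_le b
      have h3 := Real.sinh_lt_cosh s
      nlinarith

/-- The exponential map `exp_x X = cosh |X| x + (sinh |X| / |X|) X`. For fixed `X`, the curve
`t ↦ exp_x (t X)` is the geodesic with initial point `x` and initial velocity `X`. -/
def hexp {n : ℕ} (x : Hyp n) (X : tangentSpace x) : Hyp n :=
  ⟨Real.cosh (tlen X) • x.1 + (Real.sinh (tlen X) / tlen X) • X.1, exp_mem X⟩

/-- The derivative of `f` at `x` in the direction of the tangent vector `X`. -/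
def dirDeriv {n : ℕ} (f : Hyp n → ℝ) (x : Hyp n) (X : tangentSpace x) : ℝ :=
  deriv (fun t : ℝ => f (hexp x (t • X))) 0

/-- The quadratic form `∇²f (X, X)` of the Riemannian Hessian: the second derivative of `f` along
the geodesic with initial velocity `X`. -/
def hessQuad {n : ℕ} (f : Hyp n → ℝ) (x : Hyp n) (X : tangentSpace x) : ℝ :=
  iteratedDeriv 2 (fun t : ℝ => f (hexp x (t • X))) 0

/-- The Riemannian Hessian `∇²f (X, Y)`, by polarization of its quadratic form. -/
def hess {n : ℕ} (f : Hyp n → ℝ) (x : Hyp n) (X Y : tangentSpace x) : ℝ :=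
  (hessQuad f x (X + Y) - hessQuad f x (X - Y)) / 4

theorem frame_mem {n : ℕ} (x : Hyp n) (i : Fin n) :
    ((x.1.2 i, EuclideanSpace.single i 1 + (x.1.2 i / (1 + x.1.1)) • x.1.2) : Mink n) ∈
      tangentSpace x := by
  obtain ⟨⟨a, u⟩, hx, ha⟩ := x
  simp only [mink] at hx ha
  change inner ℝ u (EuclideanSpace.single i 1 + (u i / (1 + a)) • u) - a * u i = 0
  have h : inner ℝ u u = a ^ 2 - 1 := by linarith
  have h1 : (1 + a) ≠ 0 := by positivity
  rw [inner_add_right, inner_smul_right, h, EuclideanSpace.inner_single_right]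
  simp
  field_simp
  ring

/-- An orthonormal frame of `ℍⁿ`: the images of the standard basis vectors of `ℝⁿ` under the
Lorentz boost that takes `(1, 0)` to `x`. -/
def frame {n : ℕ} (x : Hyp n) (i : Fin n) : tangentSpace x :=
  ⟨(x.1.2 i, EuclideanSpace.single i 1 + (x.1.2 i / (1 + x.1.1)) • x.1.2), frame_mem x i⟩

theorem frame_orthonormal {n : ℕ} (x : Hyp n) (i j : Fin n) :
    mink (frame x i).1 (frame x j).1 = if i = j then 1 else 0 := by
  obtain ⟨⟨a, u⟩, hx, ha⟩ := x
  simp only [mink] at hx ha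
  change inner ℝ (EuclideanSpace.single i 1 + (u i / (1 + a)) • u)
    (EuclideanSpace.single j 1 + (u j / (1 + a)) • u) - u i * u j = _
  have h : inner ℝ u u = a ^ 2 - 1 := by linarith
  have h1 : (1 + a) ≠ 0 := by positivity
  have h2 : inner ℝ (EuclideanSpace.single i (1 : ℝ)) (EuclideanSpace.single j (1 : ℝ)) =
      if i = j then (1 : ℝ) else 0 := by
    simp [EuclideanSpace.inner_single_left]
  simp only [inner_add_left, inner_add_right, inner_smul_left, inner_smul_right, h, h2,
    EuclideanSpace.inner_single_left, EuclideanSpace.inner_single_right, conj_trivial]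
  field_simp
  ring

/-- The norm `|∇f|` of the Riemannian gradient at `x`. -/
def gradNorm {n : ℕ} (f : Hyp n → ℝ) (x : Hyp n) : ℝ :=
  Real.sqrt (∑ i, dirDeriv f x (frame x i) ^ 2)

/-- The matrix `f_{ij}` of the Riemannian Hessian at `x` in the orthonormal frame. -/
def hessMatrix {n : ℕ} (f : Hyp n → ℝ) (x : Hyp n) : Matrix (Fin n) (Fin n) ℝ :=
  Matrix.of fun i j => hess f x (frame x i) (frame x j)

/-- The Laplace–Beltrami operator, the trace of the Hessian. -/
def laplaceBeltrami {n : ℕ} (f : Hyp n → ℝ) (x : Hyp n) : ℝ := (hessMatrix f x).trace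

theorem chart_mem {n : ℕ} (y : EuclideanSpace ℝ (Fin n)) :
    mink ((Real.sqrt (1 + ‖y‖ ^ 2), y) : Mink n) (Real.sqrt (1 + ‖y‖ ^ 2), y) = -1 ∧
      0 < ((Real.sqrt (1 + ‖y‖ ^ 2), y) : Mink n).1 := by
  refine ⟨?_, Real.sqrt_pos.2 (by positivity)⟩
  simp only [mink, real_inner_self_eq_norm_sq]
  rw [Real.mul_self_sqrt (by positivity)]
  ring

/-- The global smooth parametrization of the hyperboloid as a graph over `ℝⁿ`. -/
def chart {n : ℕ} (y : EuclideanSpace ℝ (Fin n)) : Hyp n :=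
  ⟨(Real.sqrt (1 + ‖y‖ ^ 2), y), chart_mem y⟩

/-- `f` is of class `C²` on the (open) set `Ω`. -/
def IsC2On {n : ℕ} (f : Hyp n → ℝ) (Ω : Set (Hyp n)) : Prop :=
  ContDiffOn ℝ 2 (fun y => f (chart y)) (chart ⁻¹' Ω)

/-- `u` is a (classical) Dirichlet eigenfunction of the Laplacian on `Ω` with eigenvalue `μ`:
`Δu = -μ u` in `Ω`, `u = 0` on `∂Ω`, `u ≢ 0`. -/
structure IsDirichletEigenfunction {n : ℕ} (Ω : Set (Hyp n)) (μ : ℝ) (u : Hyp n → ℝ) : Prop where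
  c2 : IsC2On u Ω
  cont : ContinuousOn u (closure Ω)
  eqn : ∀ x ∈ Ω, laplaceBeltrami u x = -μ * u x
  bdry : ∀ x ∈ frontier Ω, u x = 0
  nontrivial : ∃ x ∈ Ω, u x ≠ 0

/-- `μ` is the first (that is, the smallest) Dirichlet eigenvalue of the Laplacian on `Ω`. -/
def IsFirstEigenvalue {n : ℕ} (Ω : Set (Hyp n)) (μ : ℝ) : Prop :=
  IsLeast {ν : ℝ | ∃ u : Hyp n → ℝ, IsDirichletEigenfunction Ω ν u} μ

/-- `v` is a first Dirichlet eigenfunction of the Laplacian on `Ω`, with the sign `v > 0`. -/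
def IsFirstEigenfunction {n : ℕ} (Ω : Set (Hyp n)) (v : Hyp n → ℝ) : Prop :=
  ∃ μ : ℝ, IsFirstEigenvalue Ω μ ∧ IsDirichletEigenfunction Ω μ v ∧ ∀ x ∈ Ω, 0 < v x

/-- A positive function `f` is strictly `lam`-log-concave on `Ω`: the matrix
`-(log f)_{ij} - lam |∇ log f| δ_{ij}` is positive definite at every point of `Ω`. -/
def StrictlyLogConcaveOn {n : ℕ} (lam : ℝ) (f : Hyp n → ℝ) (Ω : Set (Hyp n)) : Prop :=
  ∀ x ∈ Ω, 0 < f x ∧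
    Matrix.PosDef (-hessMatrix (fun y => Real.log (f y)) x -
      (lam * gradNorm (fun y => Real.log (f y)) x) • (1 : Matrix (Fin n) (Fin n) ℝ))

end HypBall

end

open Set Filter Topology

namespace HypBall

variable {n : ℕ}

/-! By symmetry the positive eigenfunction is v = f(ρ), with ρ the distance to the centre p, and ℓ =
log f solves ℓ'' + ℓ'² + (n - 1) coth ρ ℓ' = -μ. For ρ > 0 the Hessian of log v has eigenvalue ℓ''
in the radial direction and coth ρ · ℓ' in the others, while |∇ log v| = |ℓ'|. Since coth ρ > 1,
strict 1-log-concavity follows from ℓ'' < ℓ' < 0; at the centre ℓ' = 0 and ℓ'' < 0 is enough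
(`strictlyLogConcaveOn_of_profile`, `posDef_of_rank_one`).

With φ = -ℓ' the claim is 0 < φ < φ' for the Riccati equation φ' = μ + φ² - (n - 1) coth ρ φ, φ(0) =
0. At a first zero of φ' - φ its derivative would be φ (2φ + (n - 1)(1/sinh² ρ - coth ρ) - 1), which
is positive if n ≥ 2 and sinh ρ ≤ 1/2, so there is no such zero (`riccati_lt_deriv`). For n = 1 the
bound μ ≥ 1 suffices; it comes from comparing v with the supersolution 2 - cosh ρ (`le_eigenvalue`).

Symmetry needs the longest argument. Two positive solutions u, v that agree at p coincide
(`le_of_center_eq`): take the largest t with t u ≤ v; if t < 1, a strong maximum principle and a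
comparison near the boundary, both obtained from `nonneg_on_annulus`, allow a larger t. Applied to v
and its reflections fixing p, this makes v radial (`eq_of_coshDist_eq`).

Computations use s = cosh ρ = -⟨p, x⟩ in place of ρ: it is smooth at the centre too, and its Hessian
is s times the metric. -/

/-! ### The Lorentzian form and the hyperbolic cosine of the distance -/

theorem mink_comm (x y : Mink n) : mink x y = mink y x := by
  simp only [mink, real_inner_comm x.2 y.2, mul_comm]

theorem mink_add_left (x y z : Mink n) : mink (x + y) z = mink x z + mink y z := by
  simp only [mink, Prod.fst_add, Prod.snd_add, inner_add_left]; ring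

theorem mink_add_right (x y z : Mink n) : mink x (y + z) = mink x y + mink x z := by
  simp only [mink, Prod.fst_add, Prod.snd_add, inner_add_right]; ring

theorem mink_smul_left (c : ℝ) (x y : Mink n) : mink (c • x) y = c * mink x y := by
  simp only [mink, Prod.smul_fst, Prod.smul_snd, real_inner_smul_left, smul_eq_mul]; ring

theorem mink_smul_right (c : ℝ) (x y : Mink n) : mink x (c • y) = c * mink x y := by
  simp only [mink, Prod.smul_fst, Prod.smul_snd, real_inner_smul_right, smul_eq_mul]; ring

theorem mink_sub_left (x y z : Mink n) : mink (x - y) z = mink x z - mink y z := by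
  simp only [mink, Prod.fst_sub, Prod.snd_sub, inner_sub_left]; ring

theorem mink_sub_right (x y z : Mink n) : mink x (y - z) = mink x y - mink x z := by
  simp only [mink, Prod.fst_sub, Prod.snd_sub, inner_sub_right]; ring

/-- The hyperbolic cosine of the distance, `cosh d(p, x) = -⟨p, x⟩`. -/
noncomputable def coshDist (p x : Hyp n) : ℝ := -mink p.1 x.1

theorem coshDist_comm (p x : Hyp n) : coshDist p x = coshDist x p := by
  rw [coshDist, coshDist, mink_comm]

theorem coshDist_self (p : Hyp n) : coshDist p p = 1 := by
  rw [coshDist, p.2.1, neg_neg]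

theorem norm_sq_snd (x : Hyp n) : ‖x.1.2‖ ^ 2 = x.1.1 ^ 2 - 1 := by
  have := x.2.1
  simp only [mink, real_inner_self_eq_norm_sq] at this
  linarith

theorem norm_snd_lt_fst (x : Hyp n) : ‖x.1.2‖ < x.1.1 := by
  have h := norm_sq_snd x
  exact lt_of_pow_lt_pow_left₀ 2 x.2.2.le (by linarith)

/-- The factor `p.1.1 - ‖p.1.2‖` is positive, so a bound on the distance to `p` bounds the chart
coordinate; closed balls are compact for this reason. -/
theorem coshDist_ge (p x : Hyp n) : (p.1.1 - ‖p.1.2‖) * ‖x.1.2‖ ≤ coshDist p x := by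
  have h1 := real_inner_le_norm p.1.2 x.1.2
  have h2 := norm_snd_lt_fst x
  have h3 := p.2.2
  simp only [coshDist, mink]
  nlinarith

theorem mink_sub_self (x y : Hyp n) : mink (x.1 - y.1) (x.1 - y.1) = 2 * (coshDist x y - 1) := by
  rw [mink_sub_left, mink_sub_right, mink_sub_right, x.2.1, y.2.1, mink_comm y.1 x.1, coshDist]
  ring

/-- Reverse Cauchy–Schwarz: if a, b are the norms of the spatial parts, (1 + ab)² ≤ (1 + a²)(1 + b²)
amounts to (a - b)² ≥ 0. -/
theorem one_le_coshDist (p x : Hyp n) : 1 ≤ coshDist p x := by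
  have h1 := real_inner_le_norm p.1.2 x.1.2
  have h3 := p.2.2
  have h4 := x.2.2
  have h5 := norm_sq_snd p
  have h6 := norm_sq_snd x
  have h7 := norm_nonneg p.1.2
  have h8 := norm_nonneg x.1.2
  have : (1 + ‖p.1.2‖ * ‖x.1.2‖) ≤ p.1.1 * x.1.1 := by
    apply le_of_sq_le_sq _ (by positivity)
    nlinarith [sq_nonneg (‖p.1.2‖ - ‖x.1.2‖)]
  simp only [coshDist, mink]
  linarith

theorem one_lt_coshDist {p x : Hyp n} (h : x ≠ p) : 1 < coshDist p x := by
  refine lt_of_le_of_ne (one_le_coshDist p x) fun h1 => h ?_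
  have h2 := real_inner_le_norm p.1.2 x.1.2
  have h3 := p.2.2
  have h4 := x.2.2
  have h5 := norm_sq_snd p
  have h6 := norm_sq_snd x
  have h7 := norm_nonneg p.1.2
  have h8 := norm_nonneg x.1.2
  simp only [coshDist, mink] at h1
  have h9 : p.1.1 * x.1.1 ≤ 1 + ‖p.1.2‖ * ‖x.1.2‖ := by linarith
  have h10 : (p.1.1 * x.1.1) ^ 2 ≤ (1 + ‖p.1.2‖ * ‖x.1.2‖) ^ 2 := by gcongr
  have h11 : (‖p.1.2‖ - ‖x.1.2‖) ^ 2 ≤ 0 := by nlinarith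
  have h12 : ‖p.1.2‖ = ‖x.1.2‖ := by nlinarith [sq_nonneg (‖p.1.2‖ - ‖x.1.2‖)]
  have h13 : p.1.1 = x.1.1 := by
    have : p.1.1 ^ 2 = x.1.1 ^ 2 := by rw [h12] at h5; linarith
    exact (sq_eq_sq₀ h3.le h4.le).1 this
  have h14 : ‖p.1.2 - x.1.2‖ ^ 2 = 0 := by
    rw [norm_sub_sq_real]
    rw [← h13] at h1
    nlinarith
  have h15 : p.1.2 = x.1.2 := sub_eq_zero.1 (norm_eq_zero.1 (by simpa using h14))
  exact Subtype.ext (Prod.ext h13.symm h15.symm)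

theorem hdist_nonneg (p x : Hyp n) : 0 ≤ hdist p x := Real.arcosh_nonneg (one_le_coshDist p x)

theorem cosh_hdist (p x : Hyp n) : Real.cosh (hdist p x) = coshDist p x :=
  Real.cosh_arcosh (one_le_coshDist p x)

theorem mem_geodesicBall_iff {p x : Hyp n} {r : ℝ} (hr : 0 < r) :
    x ∈ geodesicBall p r ↔ coshDist p x < Real.cosh r := by
  rw [← cosh_hdist, Real.cosh_lt_cosh, abs_of_nonneg (hdist_nonneg p x), abs_of_pos hr]
  rfl

/-! ### Tangent vectors and geodesics -/

theorem tlen_nonneg {x : Hyp n} (X : tangentSpace x) : 0 ≤ tlen X := Real.sqrt_nonneg _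

theorem tlen_sq {x : Hyp n} (X : tangentSpace x) : tlen X ^ 2 = mink X.1 X.1 :=
  Real.sq_sqrt (mink_tangent_nonneg X)

theorem mink_tangent {x : Hyp n} (X : tangentSpace x) : mink x.1 X.1 = 0 := X.2

theorem eq_zero_of_tlen_eq_zero {x : Hyp n} {X : tangentSpace x} (h : tlen X = 0) : X.1 = 0 := by
  have h0 : mink X.1 X.1 = 0 := by rw [← tlen_sq, h]; ring
  have h1 := (tangent_bound X).1
  rw [h0, zero_mul] at h1
  have h2 : X.1.1 = 0 := by nlinarith [sq_nonneg X.1.1]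
  have h3 : ‖X.1.2‖ ^ 2 = 0 := by
    simpa only [mink, h2, real_inner_self_eq_norm_sq, mul_zero, sub_zero] using h0
  exact Prod.ext h2 (norm_eq_zero.1 (by simpa using h3))

theorem tlen_smul {x : Hyp n} (t : ℝ) (X : tangentSpace x) : tlen (t • X) = |t| * tlen X := by
  rw [tlen, tlen, ← Real.sqrt_sq_eq_abs, ← Real.sqrt_mul (sq_nonneg t)]
  congr 1
  change mink (t • X.1) (t • X.1) = _
  rw [mink_smul_left, mink_smul_right]; ring

/-- The geodesic with initial velocity `X`, without absolute values. -/
theorem hexp_smul {x : Hyp n} (t : ℝ) (X : tangentSpace x) :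
    (hexp x (t • X)).1 =
      Real.cosh (t * tlen X) • x.1 + (Real.sinh (t * tlen X) / tlen X) • X.1 := by
  change Real.cosh (tlen (t • X)) • x.1 + (Real.sinh (tlen (t • X)) / tlen (t • X)) • (t • X.1) = _
  rw [tlen_smul, smul_smul]
  congr 2
  · rw [← abs_of_nonneg (tlen_nonneg X), ← abs_mul, Real.cosh_abs, abs_of_nonneg (tlen_nonneg X)]
  · rcases eq_or_ne t 0 with rfl | ht
    · simp
    rcases abs_choice t with h | h <;> rw [h]
    · field_simp
    · rw [neg_mul, Real.sinh_neg]
      field_simp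

theorem hexp_zero_smul {x : Hyp n} (X : tangentSpace x) : hexp x ((0 : ℝ) • X) = x := by
  apply Subtype.ext
  rw [hexp_smul]; simp

theorem coshDist_hexp (p : Hyp n) {x : Hyp n} (t : ℝ) (X : tangentSpace x) :
    coshDist p (hexp x (t • X)) = Real.cosh (t * tlen X) * coshDist p x -
      Real.sinh (t * tlen X) / tlen X * mink p.1 X.1 := by
  rw [coshDist, hexp_smul, mink_add_right, mink_smul_right, mink_smul_right, coshDist]
  ring

theorem coshDist_hexp_self {p : Hyp n} (t : ℝ) (X : tangentSpace p) :
    coshDist p (hexp p (t • X)) = Real.cosh (t * tlen X) := by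
  rw [coshDist_hexp, mink_tangent, coshDist_self]; ring

/-- The factor l sinh (t l) is written as `l ^ 2 * (Real.sinh (t * l) / l)`, which is also right at
`l = 0`, so that derivatives of geodesics keep the shape cosh · a + (sinh / l) · b. -/
theorem hasDerivAt_cosh_mul (l t : ℝ) :
    HasDerivAt (fun t => Real.cosh (t * l)) (l ^ 2 * (Real.sinh (t * l) / l)) t := by
  have h := ((hasDerivAt_id t).mul_const l).cosh
  refine h.congr_deriv ?_
  rcases eq_or_ne l 0 with rfl | hl
  · simp
  · simp only [id]; field_simp

theorem hasDerivAt_sinh_mul_div {l : ℝ} (hl : l ≠ 0) (t : ℝ) :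
    HasDerivAt (fun t => Real.sinh (t * l) / l) (Real.cosh (t * l)) t := by
  have h := (((hasDerivAt_id t).mul_const l).sinh).div_const l
  refine h.congr_deriv ?_
  simp only [id]; field_simp

/-- A curve `t ↦ cosh (t l) a + (sinh (t l) / l) b` solves `c'' = l² c`. -/
theorem hasDerivAt_geodesic {E : Type*} [NormedAddCommGroup E] [NormedSpace ℝ E] {l : ℝ} {a b : E}
    (h : l = 0 → b = 0) (t : ℝ) :
    HasDerivAt (fun t => Real.cosh (t * l) • a + (Real.sinh (t * l) / l) • b)
      (Real.cosh (t * l) • b + (Real.sinh (t * l) / l) • (l ^ 2 • a)) t := by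
  have h1 := (hasDerivAt_cosh_mul l t).smul_const a
  rcases eq_or_ne l 0 with hl | hl
  · rw [h hl]
    simp only [smul_zero, add_zero, zero_add]
    refine h1.congr_deriv ?_
    rw [smul_smul]; ring_nf
  · refine (h1.add ((hasDerivAt_sinh_mul_div hl t).smul_const b)).congr_deriv ?_
    rw [smul_smul, mul_comm (l ^ 2), add_comm]

theorem continuous_hexp {x : Hyp n} (X : tangentSpace x) :
    Continuous fun t : ℝ => hexp x (t • X) := by
  refine Continuous.subtype_mk (f := fun t : ℝ => (hexp x (t • X)).1) ?_ _
  simp only [hexp_smul]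
  fun_prop

/-! ### Topology of balls: compactness, closure, frontier -/

theorem chart_snd (x : Hyp n) : chart x.1.2 = x := by
  apply Subtype.ext
  refine Prod.ext ?_ rfl
  change Real.sqrt (1 + ‖x.1.2‖ ^ 2) = x.1.1
  rw [norm_sq_snd, show 1 + (x.1.1 ^ 2 - 1) = x.1.1 ^ 2 by ring, Real.sqrt_sq x.2.2.le]

theorem continuous_chart : Continuous (chart : EuclideanSpace ℝ (Fin n) → Hyp n) := by
  refine Continuous.subtype_mk (f := fun y => ((Real.sqrt (1 + ‖y‖ ^ 2), y) : Mink n)) ?_ _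
  fun_prop

theorem continuous_val : Continuous (fun x : Hyp n => x.1) := continuous_subtype_val

theorem continuous_coshDist (p : Hyp n) : Continuous (coshDist p) := by
  have h := continuous_val (n := n)
  unfold coshDist mink
  fun_prop

theorem isCompact_coshDist_le (p : Hyp n) (S : ℝ) : IsCompact {x | coshDist p x ≤ S} := by
  have hp : 0 < p.1.1 - ‖p.1.2‖ := sub_pos.2 (norm_snd_lt_fst p)
  have h1 : IsCompact (chart '' Metric.closedBall (0 : EuclideanSpace ℝ (Fin n))
      (S / (p.1.1 - ‖p.1.2‖))) := (isCompact_closedBall _ _).image continuous_chart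
  refine h1.of_isClosed_subset (isClosed_le (continuous_coshDist p) continuous_const) ?_
  intro x hx
  refine ⟨x.1.2, ?_, chart_snd x⟩
  rw [mem_closedBall_zero_iff, le_div_iff₀ hp, mul_comm]
  exact (coshDist_ge p x).trans hx

theorem isOpen_geodesicBall (p : Hyp n) {r : ℝ} (hr : 0 < r) : IsOpen (geodesicBall p r) := by
  have : geodesicBall p r = {x | coshDist p x < Real.cosh r} := by
    ext x; exact mem_geodesicBall_iff hr
  rw [this]
  exact isOpen_lt (continuous_coshDist p) continuous_const

/-- Moving along the geodesic towards `p` decreases the distance to `p`. -/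
theorem mem_closure_coshDist_lt {p x : Hyp n} (hx : x ≠ p) :
    x ∈ closure {y | coshDist p y < coshDist p x} := by
  have h1 := one_lt_coshDist hx
  set s := coshDist p x with hs
  -- The vector p - s x is the projection of p to the tangent space at x; it points towards p, and
  -- cosh d(p, ·) has derivative -(s² - 1) < 0 along it.
  have hm : mink x.1 (p.1 - s • x.1) = 0 := by
    have : mink x.1 p.1 = -s := by rw [hs, coshDist, mink_comm]; ring
    rw [mink_sub_right, mink_smul_right, x.2.1, this]; ring
  let X : tangentSpace x := ⟨p.1 - s • x.1, hm⟩
  have hpX : mink p.1 X.1 = s ^ 2 - 1 := by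
    change mink p.1 (p.1 - s • x.1) = _
    have : mink p.1 x.1 = -s := by rw [hs, coshDist]; ring
    rw [mink_sub_right, mink_smul_right, p.2.1, this]; ring
  have hl : tlen X ≠ 0 := by
    intro h
    rw [eq_zero_of_tlen_eq_zero h] at hpX
    have : mink p.1 (0 : Mink n) = 0 := by simp [mink]
    nlinarith
  have hd : HasDerivAt (fun t : ℝ => coshDist p (hexp x (t • X))) (-(s ^ 2 - 1)) 0 := by
    simp only [coshDist_hexp, hpX]
    refine (((hasDerivAt_cosh_mul (tlen X) 0).mul_const s).sub
      ((hasDerivAt_sinh_mul_div hl 0).mul_const (s ^ 2 - 1))).congr_deriv ?_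
    simp
  have h0 : coshDist p (hexp x ((0 : ℝ) • X)) = s := by rw [hexp_zero_smul]
  have hev : ∀ᶠ t in 𝓝[>] (0 : ℝ), coshDist p (hexp x (t • X)) < s := by
    have := (hasDerivAt_iff_tendsto_slope.1 hd).eventually_lt_const (u := 0) (by nlinarith)
    have := this.filter_mono (nhdsWithin_mono 0 (fun t (ht : 0 < t) => ht.ne'))
    filter_upwards [this, self_mem_nhdsWithin] with t ht ht0
    rw [slope_def_field, h0, sub_zero, div_lt_iff₀ ht0, zero_mul] at ht
    linarith
  have hc : Tendsto (fun t : ℝ => hexp x (t • X)) (𝓝[>] 0) (𝓝 x) := by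
    have := (continuous_hexp X).tendsto 0
    rw [hexp_zero_smul] at this
    exact this.mono_left nhdsWithin_le_nhds
  exact mem_closure_of_tendsto hc hev

/-- Carries the continuity and boundary data, which are given on the topological closure and
frontier, over to the sets cut out by cosh d(p, ·). -/
theorem mem_closure_geodesicBall {p x : Hyp n} {r : ℝ} (hr : 0 < r)
    (hx : coshDist p x ≤ Real.cosh r) : x ∈ closure (geodesicBall p r) := by
  rcases hx.lt_or_eq with h | h
  · exact subset_closure ((mem_geodesicBall_iff hr).2 h)
  · have hne : x ≠ p := by
      rintro rfl
      rw [coshDist_self] at h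
      exact (Real.one_lt_cosh.2 hr.ne').ne h
    refine closure_mono ?_ (mem_closure_coshDist_lt hne)
    intro y hy
    exact (mem_geodesicBall_iff hr).2 (h ▸ hy)

theorem mem_frontier_geodesicBall {p x : Hyp n} {r : ℝ} (hr : 0 < r)
    (hx : coshDist p x = Real.cosh r) : x ∈ frontier (geodesicBall p r) := by
  rw [(isOpen_geodesicBall p hr).frontier_eq]
  exact ⟨mem_closure_geodesicBall hr hx.le, fun h => ((mem_geodesicBall_iff hr).1 h).ne hx⟩

/-! ### Expansions in the orthonormal frame -/

theorem mink_frame (p x : Hyp n) (i : Fin n) :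
    mink p.1 (frame x i).1 =
      p.1.2 i + (inner ℝ p.1.2 x.1.2 / (1 + x.1.1) - p.1.1) * x.1.2 i := by
  change inner ℝ p.1.2 (EuclideanSpace.single i 1 + (x.1.2 i / (1 + x.1.1)) • x.1.2)
    - p.1.1 * x.1.2 i = _
  rw [inner_add_right, real_inner_smul_right, EuclideanSpace.inner_single_right]
  simp
  ring

/-- Parseval for the tangential part of p at x: the squared gradient of cosh d(p, ·) is sinh² d(p,
·). -/
theorem sum_mink_frame_sq (p x : Hyp n) :
    ∑ i, mink p.1 (frame x i).1 ^ 2 = coshDist p x ^ 2 - 1 := by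
  simp only [mink_frame]
  set k := inner ℝ p.1.2 x.1.2 / (1 + x.1.1) - p.1.1 with hk
  have h1 : ∑ i, p.1.2 i ^ 2 = p.1.1 ^ 2 - 1 := by
    rw [← norm_sq_snd, EuclideanSpace.real_norm_sq_eq]
  have h2 : ∑ i, x.1.2 i ^ 2 = x.1.1 ^ 2 - 1 := by
    rw [← norm_sq_snd, EuclideanSpace.real_norm_sq_eq]
  have h3 : ∑ i, p.1.2 i * x.1.2 i = inner ℝ p.1.2 x.1.2 := by
    rw [PiLp.inner_apply]; simp [mul_comm]
  have h4 : ∀ i, (p.1.2 i + k * x.1.2 i) ^ 2 =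
      p.1.2 i ^ 2 + 2 * k * (p.1.2 i * x.1.2 i) + k ^ 2 * x.1.2 i ^ 2 := fun i => by ring
  simp only [h4, Finset.sum_add_distrib, ← Finset.mul_sum, h1, h2, h3]
  have hx : (1 + x.1.1) ≠ 0 := by have := x.2.2; positivity
  have hi : inner ℝ p.1.2 x.1.2 = (k + p.1.1) * (1 + x.1.1) := by rw [hk]; field_simp; ring
  simp only [coshDist, mink, hi]
  ring

/-- Expansion of a tangent vector in the orthonormal frame. -/
theorem sum_frame {x : Hyp n} (X : tangentSpace x) :
    ∑ i, mink X.1 (frame x i).1 • (frame x i).1 = X.1 := by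
  have hx := mink_tangent X
  have hx0 : (1 + x.1.1) ≠ 0 := by have := x.2.2; positivity
  have hm : ∀ i, mink X.1 (frame x i).1 = X.1.2 i - X.1.1 / (1 + x.1.1) * x.1.2 i := by
    intro i
    change inner ℝ X.1.2 (EuclideanSpace.single i 1 + (x.1.2 i / (1 + x.1.1)) • x.1.2)
      - X.1.1 * x.1.2 i = _
    have : inner ℝ X.1.2 x.1.2 = x.1.1 * X.1.1 := by
      rw [real_inner_comm]; simp only [mink] at hx; linarith
    rw [inner_add_right, real_inner_smul_right, EuclideanSpace.inner_single_right, this]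
    simp
    field_simp
    ring
  have h2 : ∑ i, x.1.2 i ^ 2 = x.1.1 ^ 2 - 1 := by
    rw [← norm_sq_snd, EuclideanSpace.real_norm_sq_eq]
  have h3 : ∑ i, X.1.2 i * x.1.2 i = x.1.1 * X.1.1 := by
    have : inner ℝ x.1.2 X.1.2 = x.1.1 * X.1.1 := by simp only [mink] at hx; linarith
    rw [← this, PiLp.inner_apply]; simp
  set k := X.1.1 / (1 + x.1.1) with hk
  have hk' : X.1.1 = k * (1 + x.1.1) := by rw [hk]; field_simp
  have h4 : ∑ i, (X.1.2 i - k * x.1.2 i) * x.1.2 i = X.1.1 := by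
    have : ∀ i, (X.1.2 i - k * x.1.2 i) * x.1.2 i =
      X.1.2 i * x.1.2 i - k * x.1.2 i ^ 2 := fun i => by ring
    simp only [this, Finset.sum_sub_distrib, ← Finset.mul_sum, h2, h3]
    rw [hk']; ring
  simp only [hm]
  refine Prod.ext ?_ ?_
  · rw [Prod.fst_sum]
    simpa only [Prod.smul_fst, frame, smul_eq_mul] using h4
  · rw [Prod.snd_sum]
    simp only [Prod.smul_snd, frame]
    ext j
    simp only [WithLp.ofLp_sum, WithLp.ofLp_smul,
      WithLp.ofLp_add, Finset.sum_apply, Pi.smul_apply, Pi.add_apply, smul_eq_mul, mul_add,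
      Finset.sum_add_distrib]
    have h5 : ∑ i, (X.1.2 i - k * x.1.2 i) * (x.1.2 i / (1 + x.1.1) * x.1.2 j) = k * x.1.2 j := by
      have : ∀ i, (X.1.2 i - k * x.1.2 i) * (x.1.2 i / (1 + x.1.1) * x.1.2 j) =
        ((X.1.2 i - k * x.1.2 i) * x.1.2 i) * (x.1.2 j / (1 + x.1.1)) := fun i => by ring
      simp only [this, ← Finset.sum_mul, h4]
      rw [hk]; ring
    rw [h5]
    simp

/-! ### Second derivatives along geodesics, Hessian and Laplacian -/

theorem deriv_comp_curve {E : Type*} [NormedAddCommGroup E] [NormedSpace ℝ E] {g : E → ℝ}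
    {c : ℝ → E} {c' : E} {t : ℝ} (hg : ContDiffAt ℝ 2 g (c t)) (hc : HasDerivAt c c' t) :
    HasDerivAt (fun t => g (c t)) (fderiv ℝ g (c t) c') t :=
  (hg.differentiableAt (by norm_num)).hasFDerivAt.comp_hasDerivAt t hc

/-- The second derivative of a `C²` function along a curve. -/
theorem iteratedDeriv_two_comp_curve {E : Type*} [NormedAddCommGroup E] [NormedSpace ℝ E]
    {g : E → ℝ} {c c' : ℝ → E} {c'' : E} (hg : ContDiffAt ℝ 2 g (c 0))
    (hc : ∀ t, HasDerivAt c (c' t) t) (hc' : HasDerivAt c' c'' 0) :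
    iteratedDeriv 2 (fun t => g (c t)) 0 =
      fderiv ℝ (fderiv ℝ g) (c 0) (c' 0) (c' 0) + fderiv ℝ g (c 0) c'' := by
  have h1 : deriv (fun t => g (c t)) =ᶠ[𝓝 0] fun t => fderiv ℝ g (c t) (c' t) := by
    have := (hc 0).continuousAt.eventually (hg.eventually (by simp))
    filter_upwards [this] with t ht
    exact (deriv_comp_curve ht (hc t)).deriv
  have h2 : HasDerivAt (fun t => fderiv ℝ g (c t)) (fderiv ℝ (fderiv ℝ g) (c 0) (c' 0)) 0 :=
    ((hg.fderiv_right (m := 1) (by norm_num)).differentiableAt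
      (by norm_num)).hasFDerivAt.comp_hasDerivAt 0 (hc 0)
  rw [iteratedDeriv_succ, iteratedDeriv_one, h1.deriv_eq]
  exact (h2.clm_apply hc').deriv

theorem contDiffAt_deriv {f : ℝ → ℝ} {t : ℝ} (hf : ContDiffAt ℝ 2 f t) :
    ContDiffAt ℝ 1 (deriv f) t :=
  (hf.fderiv_right (m := 1) (by norm_num)).clm_apply contDiffAt_const

theorem iteratedDeriv_two_comp_curve_real {g c c' : ℝ → ℝ} {c'' t : ℝ} (hg : ContDiffAt ℝ 2 g (c t))
    (hc : ∀ t, HasDerivAt c (c' t) t) (hc' : HasDerivAt c' c'' t) :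
    iteratedDeriv 2 (fun t => g (c t)) t =
      deriv (deriv g) (c t) * c' t ^ 2 + deriv g (c t) * c'' := by
  have h1 : deriv (fun t => g (c t)) =ᶠ[𝓝 t] fun t => deriv g (c t) * c' t := by
    have := (hc t).continuousAt.eventually (hg.eventually (by simp))
    filter_upwards [this] with t ht
    exact ((ht.differentiableAt (by norm_num)).hasDerivAt.comp t (hc t)).deriv
  have h2 : HasDerivAt (fun t => deriv g (c t)) (deriv (deriv g) (c t) * c' t) t := by
    exact ((contDiffAt_deriv hg).differentiableAt (by norm_num)).hasDerivAt.comp t (hc t)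
  rw [iteratedDeriv_succ, iteratedDeriv_one, h1.deriv_eq]
  refine ((h2.mul hc').congr_deriv ?_).deriv
  ring

/-- A negative second derivative would make the minimum a local maximum as well, hence `f` locally
constant with zero second derivative. -/
theorem iteratedDeriv_two_nonneg_of_isLocalMin {f : ℝ → ℝ} {t : ℝ} (h : IsLocalMin f t)
    (hc : ContinuousAt f t) : 0 ≤ iteratedDeriv 2 f t := by
  rw [iteratedDeriv_succ, iteratedDeriv_one]
  by_contra hneg
  push Not at hneg
  have hmax := isLocalMax_of_deriv_deriv_neg hneg h.deriv_eq_zero hc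
  have heq : f =ᶠ[𝓝 t] fun _ => f t := by
    filter_upwards [h, hmax] with y h1 h2 using le_antisymm h2 h1
  have : deriv (deriv f) t = 0 := by
    rw [(heq.deriv).deriv_eq]; simp
  exact hneg.ne this

/-- `f` is of class `C²` in a neighbourhood of `x`. -/
def IsC2At (f : Hyp n → ℝ) (x : Hyp n) : Prop :=
  ContDiffAt ℝ 2 (fun y => f (chart y)) x.1.2

theorem IsC2On.isC2At {f : Hyp n → ℝ} {Ω : Set (Hyp n)} (h : IsC2On f Ω) (hΩ : IsOpen Ω)
    {x : Hyp n} (hx : x ∈ Ω) : IsC2At f x := by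
  refine h.contDiffAt ((hΩ.preimage continuous_chart).mem_nhds ?_)
  rw [mem_preimage, chart_snd]; exact hx

theorem IsC2At.sub_const_mul {f g : Hyp n → ℝ} {x : Hyp n} (hf : IsC2At f x) (hg : IsC2At g x)
    (c : ℝ) : IsC2At (fun y => f y - c * g y) x :=
  ContDiffAt.sub hf (contDiffAt_const.mul hg)

theorem comp_hexp_eq (f : Hyp n → ℝ) {x : Hyp n} (X : tangentSpace x) :
    (fun t : ℝ => f (hexp x (t • X))) = fun t => f (chart
      (Real.cosh (t * tlen X) • x.1.2 + (Real.sinh (t * tlen X) / tlen X) • X.1.2)) := by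
  ext t
  rw [← chart_snd (hexp x (t • X)), hexp_smul]
  simp

theorem snd_eq_zero_of_tlen_eq_zero {x : Hyp n} {X : tangentSpace x} (h : tlen X = 0) :
    X.1.2 = 0 := by rw [eq_zero_of_tlen_eq_zero h]; rfl

/-- In the chart a geodesic has acceleration ⟨X, X⟩ x at time 0, which produces the second,
Christoffel-type term. The formula shows that the Hessian is quadratic in `X`. -/
theorem hessQuad_eq {f : Hyp n → ℝ} {x : Hyp n} (hf : IsC2At f x) (X : tangentSpace x) :
    hessQuad f x X = fderiv ℝ (fderiv ℝ fun y => f (chart y)) x.1.2 X.1.2 X.1.2 +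
      mink X.1 X.1 * fderiv ℝ (fun y => f (chart y)) x.1.2 x.1.2 := by
  rw [hessQuad, comp_hexp_eq]
  have h0 := fun h : tlen X = 0 => snd_eq_zero_of_tlen_eq_zero h
  have key := iteratedDeriv_two_comp_curve (g := fun y => f (chart y))
    (c := fun t => Real.cosh (t * tlen X) • x.1.2 + (Real.sinh (t * tlen X) / tlen X) • X.1.2)
    (by simpa [IsC2At] using hf) (hasDerivAt_geodesic h0)
    (hasDerivAt_geodesic (fun h => by rw [h]; simp) 0)
  rw [key]
  simp [tlen_sq]

theorem contDiffAt_along_geodesic {f : Hyp n → ℝ} {x : Hyp n} (X : tangentSpace x) {t : ℝ}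
    (hf : IsC2At f (hexp x (t • X))) : ContDiffAt ℝ 2 (fun t : ℝ => f (hexp x (t • X))) t := by
  rw [comp_hexp_eq]
  refine ContDiffAt.comp (g := fun y => f (chart y)) t ?_ (by fun_prop)
  rw [IsC2At, hexp_smul] at hf
  exact hf

theorem IsC2At.contDiffAt_comp_hexp {f : Hyp n → ℝ} {x : Hyp n} (hf : IsC2At f x)
    (X : tangentSpace x) : ContDiffAt ℝ 2 (fun t : ℝ => f (hexp x (t • X))) 0 :=
  contDiffAt_along_geodesic X (by rwa [hexp_zero_smul])

/-- On the diagonal, polarization evaluates the form at 2X and at 0, so homogeneity of degree two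
recovers its value at X. -/
theorem laplaceBeltrami_eq_sum {f : Hyp n → ℝ} {x : Hyp n} (hf : IsC2At f x) :
    laplaceBeltrami f x = ∑ i, hessQuad f x (frame x i) := by
  rw [laplaceBeltrami, Matrix.trace]
  refine Finset.sum_congr rfl fun i _ => ?_
  simp only [hessMatrix, Matrix.diag_apply, Matrix.of_apply, hess, sub_self, hessQuad_eq hf]
  change (fderiv ℝ (fderiv ℝ fun y => f (chart y)) x.1.2 ((frame x i).1.2 + (frame x i).1.2)
    ((frame x i).1.2 + (frame x i).1.2) + mink ((frame x i).1 + (frame x i).1)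
    ((frame x i).1 + (frame x i).1) * _ - (fderiv ℝ (fderiv ℝ fun y => f (chart y)) x.1.2 0 0 +
    mink 0 0 * _)) / 4 = _
  have : mink (0 : Mink n) 0 = 0 := by simp [mink]
  rw [this, mink_add_left, mink_add_right]
  simp
  ring

theorem iteratedDeriv_two_sub_const_mul {f g : ℝ → ℝ} {t : ℝ} (hf : ContDiffAt ℝ 2 f t)
    (hg : ContDiffAt ℝ 2 g t) (c : ℝ) :
    iteratedDeriv 2 (fun t => f t - c * g t) t = iteratedDeriv 2 f t - c * iteratedDeriv 2 g t := by
  have h1 : ContDiffAt ℝ ((2 : ℕ) : WithTop ℕ∞) f t := hf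
  have h2 : ContDiffAt ℝ ((2 : ℕ) : WithTop ℕ∞) g t := hg
  rw [iteratedDeriv_fun_sub h1 (contDiffAt_const.mul h2), iteratedDeriv_const_mul_field]

theorem hessQuad_sub_const_mul {f g : Hyp n → ℝ} {x : Hyp n} (hf : IsC2At f x) (hg : IsC2At g x)
    (c : ℝ) (X : tangentSpace x) :
    hessQuad (fun y => f y - c * g y) x X = hessQuad f x X - c * hessQuad g x X :=
  iteratedDeriv_two_sub_const_mul (hf.contDiffAt_comp_hexp X) (hg.contDiffAt_comp_hexp X) c

theorem laplaceBeltrami_sub_const_mul {f g : Hyp n → ℝ} {x : Hyp n} (hf : IsC2At f x)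
    (hg : IsC2At g x) (c : ℝ) :
    laplaceBeltrami (fun y => f y - c * g y) x = laplaceBeltrami f x - c * laplaceBeltrami g x := by
  rw [laplaceBeltrami_eq_sum (hf.sub_const_mul hg c), laplaceBeltrami_eq_sum hf,
    laplaceBeltrami_eq_sum hg, Finset.mul_sum, ← Finset.sum_sub_distrib]
  exact Finset.sum_congr rfl fun i _ => hessQuad_sub_const_mul hf hg c _

theorem laplaceBeltrami_nonneg_of_isLocalMin {f : Hyp n → ℝ} {x : Hyp n} (hf : IsC2At f x)
    (h : IsLocalMin f x) : 0 ≤ laplaceBeltrami f x := by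
  rw [laplaceBeltrami_eq_sum hf]
  refine Finset.sum_nonneg fun i _ => iteratedDeriv_two_nonneg_of_isLocalMin ?_
    (hf.contDiffAt_comp_hexp _).continuousAt
  have hc := (continuous_hexp (frame x i)).tendsto 0
  rw [hexp_zero_smul] at hc
  have := hc.eventually h
  simpa only [IsLocalMin, IsMinFilter, hexp_zero_smul] using this

/-! ### Functions of cosh d(p, ·) -/

/-- The distance function along a geodesic, and its derivatives. -/
theorem hasDerivAt_coshDist_hexp (p : Hyp n) {x : Hyp n} (X : tangentSpace x) :
    ∃ c' : ℝ → ℝ, (∀ t, HasDerivAt (fun t : ℝ => coshDist p (hexp x (t • X))) (c' t) t) ∧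
      HasDerivAt c' (mink X.1 X.1 * coshDist p x) 0 ∧ c' 0 = -mink p.1 X.1 := by
  have h0 : tlen X = 0 → -mink p.1 X.1 = 0 := by
    intro h
    rw [eq_zero_of_tlen_eq_zero h]; simp [mink]
  refine ⟨fun t => Real.cosh (t * tlen X) • (-mink p.1 X.1) +
    (Real.sinh (t * tlen X) / tlen X) • (tlen X ^ 2 • coshDist p x), fun t => ?_, ?_, by simp⟩
  · have := hasDerivAt_geodesic (a := coshDist p x) h0 t
    have heq : (fun t : ℝ => coshDist p (hexp x (t • X))) = fun t =>
        Real.cosh (t * tlen X) • coshDist p x + (Real.sinh (t * tlen X) / tlen X) •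
          (-mink p.1 X.1) := by
      funext t
      rw [coshDist_hexp]
      simp only [smul_eq_mul]; ring
    rw [heq]
    exact this
  · refine (hasDerivAt_geodesic (a := -mink p.1 X.1) (b := tlen X ^ 2 • coshDist p x)
      (fun h => by rw [h]; simp) 0).congr_deriv ?_
    simp [tlen_sq]

/-- Chain rule: along a geodesic, cosh d(p, ·) solves c'' = ⟨X, X⟩ c. -/
theorem hessQuad_comp_coshDist {G : ℝ → ℝ} {p x : Hyp n} (hG : ContDiffAt ℝ 2 G (coshDist p x))
    (X : tangentSpace x) :
    hessQuad (fun y => G (coshDist p y)) x X =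
      deriv (deriv G) (coshDist p x) * mink p.1 X.1 ^ 2 +
        deriv G (coshDist p x) * (mink X.1 X.1 * coshDist p x) := by
  obtain ⟨c', h1, h2, h3⟩ := hasDerivAt_coshDist_hexp p X
  have := iteratedDeriv_two_comp_curve_real (g := G) (t := 0) (by simpa only [hexp_zero_smul] using hG) h1 h2
  rw [hessQuad, this, h3, hexp_zero_smul]
  ring

theorem dirDeriv_comp_coshDist {G : ℝ → ℝ} {p x : Hyp n} (hG : ContDiffAt ℝ 2 G (coshDist p x))
    (X : tangentSpace x) :
    dirDeriv (fun y => G (coshDist p y)) x X = -deriv G (coshDist p x) * mink p.1 X.1 := by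
  obtain ⟨c', h1, h2, h3⟩ := hasDerivAt_coshDist_hexp p X
  have hG' : HasDerivAt G (deriv G (coshDist p x)) (coshDist p (hexp x ((0 : ℝ) • X))) := by
    rw [hexp_zero_smul]
    exact (hG.differentiableAt (by norm_num)).hasDerivAt
  rw [dirDeriv]
  refine ((hG'.comp (0 : ℝ) (h1 0)).congr_deriv ?_).deriv
  rw [h3]; ring

theorem isC2At_coshDist (p x : Hyp n) : IsC2At (coshDist p) x := by
  unfold IsC2At coshDist mink chart
  have h : ∀ y : EuclideanSpace ℝ (Fin n), (1 + ‖y‖ ^ 2) ≠ 0 := fun y => by positivity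
  have h1 : ContDiffAt ℝ 2 (fun y : EuclideanSpace ℝ (Fin n) => √(1 + ‖y‖ ^ 2)) x.1.2 :=
    ContDiffAt.sqrt (contDiffAt_const.add (contDiff_norm_sq ℝ).contDiffAt) (h _)
  have h2 : ContDiffAt ℝ 2 (fun y : EuclideanSpace ℝ (Fin n) => (inner ℝ p.1.2 y : ℝ)) x.1.2 :=
    contDiffAt_const.inner ℝ contDiffAt_id
  exact (h2.sub (contDiffAt_const.mul h1)).neg

theorem isC2At_comp_coshDist {G : ℝ → ℝ} {p x : Hyp n} (hG : ContDiffAt ℝ 2 G (coshDist p x)) :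
    IsC2At (fun y => G (coshDist p y)) x := by
  refine ContDiffAt.comp (g := G) x.1.2 ?_ (isC2At_coshDist p x)
  rw [chart_snd]; exact hG

theorem laplaceBeltrami_comp_coshDist {G : ℝ → ℝ} {p x : Hyp n}
    (hG : ContDiffAt ℝ 2 G (coshDist p x)) :
    laplaceBeltrami (fun y => G (coshDist p y)) x =
      deriv (deriv G) (coshDist p x) * (coshDist p x ^ 2 - 1) +
        n * (deriv G (coshDist p x) * coshDist p x) := by
  rw [laplaceBeltrami_eq_sum (isC2At_comp_coshDist hG)]
  simp only [hessQuad_comp_coshDist hG, frame_orthonormal, Finset.sum_add_distrib, ← Finset.mul_sum,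
    sum_mink_frame_sq]
  simp
  ring

/-! ### Invariance of the Laplacian under change of frame and reflection -/

/-- The Laplacian can be computed in any orthonormal frame. -/
theorem laplaceBeltrami_eq_sum_of_orthonormal {f : Hyp n → ℝ} {x : Hyp n} (hf : IsC2At f x)
    (E : Fin n → tangentSpace x) (hE : ∀ i j, mink (E i).1 (E j).1 = if i = j then 1 else 0) :
    laplaceBeltrami f x = ∑ i, hessQuad f x (E i) := by
  rw [laplaceBeltrami_eq_sum hf]
  simp only [hessQuad_eq hf, hE, frame_orthonormal, Finset.sum_add_distrib]
  congr 1
  set B := fderiv ℝ (fderiv ℝ fun y => f (chart y)) x.1.2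
  let O : Matrix (Fin n) (Fin n) ℝ := Matrix.of fun i j => mink (E i).1 (frame x j).1
  have hexpand : ∀ i, (E i).1.2 = ∑ j, O i j • (frame x j).1.2 := by
    intro i
    have := congrArg Prod.snd (sum_frame (E i))
    rw [Prod.snd_sum] at this
    exact this.symm
  have hO : O * O.transpose = 1 := by
    ext i j
    rw [Matrix.mul_apply, Matrix.one_apply, ← hE i j]
    have : mink (E i).1 (E j).1 = mink (E i).1 (∑ k, O j k • (frame x k).1) := by
      rw [show ∑ k, O j k • (frame x k).1 = (E j).1 from sum_frame (E j)]
    rw [this]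
    let L : Mink n →ₗ[ℝ] ℝ :=
      { toFun := mink (E i).1
        map_add' := mink_add_right _
        map_smul' := fun c y => mink_smul_right c _ y }
    change _ = L _
    rw [map_sum]
    refine Finset.sum_congr rfl fun k _ => ?_
    rw [map_smul, smul_eq_mul, mul_comm]
    rfl
  -- Expansion in the frame gives orthonormal rows; the trace computation needs orthonormal columns.
  have hOt : O.transpose * O = 1 := mul_eq_one_comm.1 hO
  have hcols : ∀ j k, ∑ i, O i j * O i k = if j = k then 1 else 0 := by
    intro j k
    have := congrFun (congrFun hOt j) k
    rwa [Matrix.mul_apply, Matrix.one_apply] at this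
  symm
  calc ∑ i, B (E i).1.2 (E i).1.2
      = ∑ i, ∑ j, ∑ k, (O i j * O i k) * B (frame x j).1.2 (frame x k).1.2 := by
        refine Finset.sum_congr rfl fun i _ => ?_
        rw [hexpand i]
        simp only [map_sum, sum_apply, map_smul, smul_apply,
          smul_eq_mul]
        rw [Finset.sum_comm]
        simp only [Finset.mul_sum, mul_assoc, mul_left_comm]
    _ = ∑ j, ∑ k, (∑ i, O i j * O i k) * B (frame x j).1.2 (frame x k).1.2 := by
        rw [Finset.sum_comm]
        refine Finset.sum_congr rfl fun j _ => ?_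
        rw [Finset.sum_comm]
        simp only [Finset.sum_mul]
    _ = ∑ j, B (frame x j).1.2 (frame x j).1.2 := by
        simp [hcols]

/-- The Lorentz reflection in the hyperplane orthogonal to `N`. -/
noncomputable def reflection (N z : Mink n) : Mink n := z - (2 * mink z N / mink N N) • N

theorem mink_reflection (N z w : Mink n) :
    mink (reflection N z) (reflection N w) = mink z w := by
  simp only [reflection, mink_sub_left, mink_sub_right, mink_smul_left, mink_smul_right,
    mink_comm N w]
  -- For null N, division by zero makes the coefficient 0 and the reflection the identity.
  rcases eq_or_ne (mink N N) 0 with h | h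
  · simp [h]
  · field_simp; ring

theorem reflection_mem {N : Mink n} {p : Hyp n} (hp : mink p.1 N = 0) (z : Hyp n) :
    mink (reflection N z.1) (reflection N z.1) = -1 ∧ 0 < (reflection N z.1).1 := by
  have h1 : mink (reflection N z.1) (reflection N z.1) = -1 := by rw [mink_reflection, z.2.1]
  refine ⟨h1, ?_⟩
  have hp' : reflection N p.1 = p.1 := by simp [reflection, hp]
  have h2 : mink p.1 (reflection N z.1) = mink p.1 z.1 := by
    conv_lhs => rw [← hp']
    exact mink_reflection N p.1 z.1
  have h3 := one_le_coshDist p z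
  rw [coshDist, ← h2] at h3
  by_contra hneg
  push Not at hneg
  set w := reflection N z.1
  have h4 : ‖w.2‖ ^ 2 = w.1 ^ 2 - 1 := by
    simp only [mink, real_inner_self_eq_norm_sq] at h1; linarith
  have h5 : w.1 < 0 := by
    rcases hneg.lt_or_eq with h | h
    · exact h
    · rw [h] at h4; nlinarith [sq_nonneg ‖w.2‖]
  -- If w lay on the lower sheet, -w would be a point of hyperbolic space, giving ⟨p, w⟩ ≥ 1 and
  -- contradicting ⟨p, w⟩ = ⟨p, z⟩ ≤ -1.
  have h6 := one_le_coshDist p ⟨(-1 : ℝ) • w, by rw [mink_smul_left, mink_smul_right, h1]; norm_num,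
    by simpa using h5⟩
  change 1 ≤ -mink p.1 ((-1 : ℝ) • w) at h6
  rw [mink_smul_right] at h6
  linarith

/-- The reflection in a hyperplane through `p`, as an isometry of hyperbolic space. -/
noncomputable def hypReflection {N : Mink n} {p : Hyp n} (hp : mink p.1 N = 0) (z : Hyp n) : Hyp n :=
  ⟨reflection N z.1, reflection_mem hp z⟩

section Reflection

variable {N : Mink n} {p : Hyp n} (hp : mink p.1 N = 0)

theorem hypReflection_center : hypReflection hp p = p :=
  Subtype.ext (by simp [hypReflection, reflection, hp])

theorem coshDist_hypReflection (z : Hyp n) : coshDist p (hypReflection hp z) = coshDist p z := by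
  have h := mink_reflection N p.1 z.1
  rw [show reflection N p.1 = p.1 by simp [reflection, hp]] at h
  exact congrArg Neg.neg h

theorem continuous_hypReflection : Continuous (hypReflection hp) := by
  refine Continuous.subtype_mk (f := fun z : Hyp n => reflection N z.1) ?_ _
  have h := continuous_val (n := n)
  unfold reflection mink
  fun_prop

/-- The differential of the reflection. -/
noncomputable def tangentReflection {z : Hyp n} (X : tangentSpace z) :
    tangentSpace (hypReflection hp z) :=
  ⟨reflection N X.1, (mink_reflection N z.1 X.1).trans X.2⟩

theorem tlen_tangentReflection {z : Hyp n} (X : tangentSpace z) :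
    tlen (tangentReflection hp X) = tlen X := by
  simp only [tlen, tangentReflection, mink_reflection]

theorem hypReflection_hexp {z : Hyp n} (t : ℝ) (X : tangentSpace z) :
    hypReflection hp (hexp z (t • X)) = hexp (hypReflection hp z) (t • tangentReflection hp X) := by
  apply Subtype.ext
  rw [hexp_smul, tlen_tangentReflection]
  simp only [hypReflection, tangentReflection, hexp_smul, reflection, mink_add_left, mink_smul_left]
  module

theorem hessQuad_comp_hypReflection (f : Hyp n → ℝ) {z : Hyp n} (X : tangentSpace z) :
    hessQuad (fun y => f (hypReflection hp y)) z X =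
      hessQuad f (hypReflection hp z) (tangentReflection hp X) := by
  simp only [hessQuad, hypReflection_hexp]

theorem isC2At_comp_hypReflection {f : Hyp n → ℝ} {z : Hyp n} (hf : IsC2At f (hypReflection hp z)) :
    IsC2At (fun y => f (hypReflection hp y)) z := by
  have h : (fun y => f (hypReflection hp (chart y))) =
      (fun y => f (chart y)) ∘ fun y => (reflection N (chart y).1).2 := by
    ext y
    simp only [Function.comp]
    rw [show (reflection N (chart y).1).2 = (hypReflection hp (chart y)).1.2 from rfl, chart_snd]
  unfold IsC2At
  rw [h]
  refine ContDiffAt.comp z.1.2 ?_ ?_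
  · rw [chart_snd]; exact hf
  · unfold reflection chart mink
    have h1 : ContDiffAt ℝ 2 (fun y : EuclideanSpace ℝ (Fin n) => √(1 + ‖y‖ ^ 2)) z.1.2 :=
      ContDiffAt.sqrt (contDiffAt_const.add (contDiff_norm_sq ℝ).contDiffAt) (by positivity)
    have h2 : ContDiffAt ℝ 2 (fun y : EuclideanSpace ℝ (Fin n) => (inner ℝ y N.2 : ℝ)) z.1.2 :=
      contDiffAt_id.inner ℝ contDiffAt_const
    simp only [Prod.snd_sub, Prod.smul_snd]
    fun_prop

theorem laplaceBeltrami_comp_hypReflection {f : Hyp n → ℝ} {z : Hyp n}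
    (hf : IsC2At f (hypReflection hp z)) :
    laplaceBeltrami (fun y => f (hypReflection hp y)) z = laplaceBeltrami f (hypReflection hp z) := by
  rw [laplaceBeltrami_eq_sum (isC2At_comp_hypReflection hp hf),
    laplaceBeltrami_eq_sum_of_orthonormal hf fun i => tangentReflection hp (frame z i)]
  · simp only [hessQuad_comp_hypReflection]
  · intro i j
    rw [← frame_orthonormal z i j]
    exact mink_reflection N _ _

end Reflection

/-- Two points at the same distance from `p` are exchanged by a reflection fixing `p`. -/
theorem exists_hypReflection {p x y : Hyp n} (h : coshDist p x = coshDist p y) :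
    ∃ (N : Mink n) (hp : mink p.1 N = 0), hypReflection hp x = y ∧ hypReflection hp y = x := by
  -- The mirror is the perpendicular bisector of x and y, with normal x - y; it contains p because
  -- the distances agree.
  have hp : mink p.1 (x.1 - y.1) = 0 := by
    rw [mink_sub_right]; simp only [coshDist] at h; linarith
  refine ⟨x.1 - y.1, hp, ?_⟩
  rcases eq_or_ne x y with rfl | hne
  · constructor <;> exact Subtype.ext (by simp [hypReflection, reflection])
  have h1 := one_lt_coshDist hne
  rw [coshDist_comm] at h1
  have h2 : (2 * (coshDist x y - 1)) ≠ 0 := by linarith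
  have hs := mink_sub_self x y
  have hx : 2 * mink x.1 (x.1 - y.1) / mink (x.1 - y.1) (x.1 - y.1) = 1 := by
    rw [hs, div_eq_one_iff_eq h2, mink_sub_right, x.2.1, coshDist]; ring
  have hy : 2 * mink y.1 (x.1 - y.1) / mink (x.1 - y.1) (x.1 - y.1) = -1 := by
    rw [hs, div_eq_iff h2, mink_sub_right, y.2.1, mink_comm, coshDist]; ring
  constructor <;> apply Subtype.ext
  · change x.1 - (2 * mink x.1 (x.1 - y.1) / mink (x.1 - y.1) (x.1 - y.1)) • (x.1 - y.1) = y.1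
    rw [hx]; module
  · change y.1 - (2 * mink y.1 (x.1 - y.1) / mink (x.1 - y.1) (x.1 - y.1)) • (x.1 - y.1) = x.1
    rw [hy]; module

/-! ### The comparison principle -/

/-- A comparison principle on the annulus `s₁ ≤ cosh d(p, ·) ≤ S`, for a radial positive function
`h` which is a supersolution relative to `Z`. -/
theorem nonneg_on_annulus {p : Hyp n} {s₁ S : ℝ} {Z : Hyp n → ℝ} {h : ℝ → ℝ}
    (hZ : ContinuousOn Z {x | coshDist p x ≤ S}) (hh : ContDiff ℝ 2 h)
    (hpos : ∀ s, 1 ≤ s → s₁ ≤ s → s ≤ S → 0 < h s)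
    (hin : ∀ x, coshDist p x = s₁ → 0 ≤ Z x) (hout : ∀ x, coshDist p x = S → 0 ≤ Z x)
    (hc2 : ∀ x, coshDist p x < S → IsC2At Z x)
    (hlap : ∀ x, s₁ < coshDist p x → coshDist p x < S → Z x < 0 →
      laplaceBeltrami Z x * h (coshDist p x) <
        Z x * (deriv (deriv h) (coshDist p x) * (coshDist p x ^ 2 - 1) +
          n * (deriv h (coshDist p x) * coshDist p x)))
    (x : Hyp n) (hx₁ : s₁ ≤ coshDist p x) (hxS : coshDist p x ≤ S) : 0 ≤ Z x := by
  by_contra hneg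
  push Not at hneg
  set K := {x | coshDist p x ≤ S} ∩ {x | s₁ ≤ coshDist p x}
  have hK : IsCompact K := (isCompact_coshDist_le p S).inter_right
    (isClosed_le continuous_const (continuous_coshDist p))
  have hposK : ∀ y ∈ K, 0 < h (coshDist p y) := fun y hy =>
    hpos _ (one_le_coshDist p y) hy.2 hy.1
  have hq : ContinuousOn (fun y => Z y / h (coshDist p y)) K :=
    (hZ.mono inter_subset_left).div
      ((hh.continuous.comp (continuous_coshDist p)).continuousOn) fun y hy => (hposK y hy).ne'
  obtain ⟨y, hyK, hy⟩ := hK.exists_isMinOn ⟨x, hxS, hx₁⟩ hq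
  set m := Z y / h (coshDist p y) with hm
  have hy0 := hposK y hyK
  have hm0 : m < 0 := (hy (show x ∈ K from ⟨hxS, hx₁⟩)).trans_lt
    (div_neg_of_neg_of_pos hneg (hposK x ⟨hxS, hx₁⟩))
  have hZy : Z y = m * h (coshDist p y) := by rw [hm]; field_simp
  have hZy0 : Z y < 0 := by rw [hZy]; exact mul_neg_of_neg_of_pos hm0 hy0
  have hyS : coshDist p y < S := lt_of_le_of_ne hyK.1 fun h => (hout y h).not_gt hZy0
  have hy₁ : s₁ < coshDist p y := lt_of_le_of_ne hyK.2 fun h => (hin y h.symm).not_gt hZy0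
  have hC := hc2 y hyS
  have hCh : IsC2At (fun y => h (coshDist p y)) y := isC2At_comp_coshDist hh.contDiffAt
  -- At a negative minimum m of Z/h, the function Z - m h has a local minimum with value 0, so ΔZ ≥
  -- m Δh there, against `hlap`.
  have hloc : IsLocalMin (fun z => Z z - m * h (coshDist p z)) y := by
    have hnhds : ∀ᶠ z in 𝓝 y, s₁ < coshDist p z ∧ coshDist p z < S :=
      ((continuous_coshDist p).continuousAt.eventually (lt_mem_nhds hy₁)).and
        ((continuous_coshDist p).continuousAt.eventually (gt_mem_nhds hyS))
    filter_upwards [hnhds] with z hz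
    have hzK : z ∈ K := ⟨hz.2.le, hz.1.le⟩
    have h1 : m ≤ Z z / h (coshDist p z) := hy hzK
    rw [le_div_iff₀ (hposK z hzK)] at h1
    rw [hZy]
    linarith
  have h2 := laplaceBeltrami_nonneg_of_isLocalMin (hC.sub_const_mul hCh m) hloc
  rw [laplaceBeltrami_sub_const_mul hC hCh, laplaceBeltrami_comp_coshDist hh.contDiffAt] at h2
  have h3 := hlap y hy₁ hyS hZy0
  rw [hZy] at h3
  nlinarith

/-! ### Positive Dirichlet solutions: eigenvalue bound, uniqueness, symmetry -/

/-- `w` solves `Δw = -μ w` in the ball `cosh d(p, ·) < S` and vanishes on its boundary. -/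
structure IsDirichletSolution (p : Hyp n) (S μ : ℝ) (w : Hyp n → ℝ) : Prop where
  c2 : ∀ x, coshDist p x < S → IsC2At w x
  cont : ContinuousOn w {x | coshDist p x ≤ S}
  eqn : ∀ x, coshDist p x < S → laplaceBeltrami w x = -μ * w x
  bdry : ∀ x, coshDist p x = S → w x = 0

theorem IsDirichletEigenfunction.isDirichletSolution {p : Hyp n} {r μ : ℝ} {v : Hyp n → ℝ}
    (hr : 0 < r) (h : IsDirichletEigenfunction (geodesicBall p r) μ v) :
    IsDirichletSolution p (Real.cosh r) μ v where
  c2 _ hx := h.c2.isC2At (isOpen_geodesicBall p hr) ((mem_geodesicBall_iff hr).2 hx)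
  cont := h.cont.mono fun _ hx => mem_closure_geodesicBall hr hx
  eqn x hx := h.eqn x ((mem_geodesicBall_iff hr).2 hx)
  bdry x hx := h.bdry x (mem_frontier_geodesicBall hr hx)

namespace IsDirichletSolution

variable {p : Hyp n} {S μ : ℝ} {u v w : Hyp n → ℝ}

theorem sub_const_mul (hw : IsDirichletSolution p S μ w) (hu : IsDirichletSolution p S μ u)
    (c : ℝ) : IsDirichletSolution p S μ (fun x => w x - c * u x) where
  c2 x hx := (hw.c2 x hx).sub_const_mul (hu.c2 x hx) c
  cont := hw.cont.sub (continuousOn_const.mul hu.cont)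
  eqn x hx := by
    rw [laplaceBeltrami_sub_const_mul (hw.c2 x hx) (hu.c2 x hx), hw.eqn x hx, hu.eqn x hx]
    ring
  bdry x hx := by rw [hw.bdry x hx, hu.bdry x hx]; ring

theorem comp_hypReflection (hw : IsDirichletSolution p S μ w) {N : Mink n} (hp : mink p.1 N = 0) :
    IsDirichletSolution p S μ (fun x => w (hypReflection hp x)) where
  c2 x hx := isC2At_comp_hypReflection hp (hw.c2 _ (by rwa [coshDist_hypReflection]))
  cont := hw.cont.comp (continuous_hypReflection hp).continuousOn fun x hx => by
    rw [mem_ofPred_eq, coshDist_hypReflection]; exact hx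
  eqn x hx := by
    have hx' : coshDist p (hypReflection hp x) < S := by rwa [coshDist_hypReflection]
    rw [laplaceBeltrami_comp_hypReflection hp (hw.c2 _ hx'), hw.eqn _ hx']
  bdry x hx := hw.bdry _ (by rwa [coshDist_hypReflection])

/-- A lower bound for the eigenvalue of a positive eigenfunction. -/
theorem le_eigenvalue (hv : IsDirichletSolution p S μ v)
    (hpos : ∀ x, coshDist p x < S → 0 < v x) (hS : 1 < S) (hS2 : S < 2) : (n : ℝ) ≤ μ := by
  by_contra hlt
  push Not at hlt
  have hd : deriv (fun s : ℝ => 2 - s) = fun _ => -1 := by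
    ext s; simp
  -- This is -v. If μ < n, then 2 - s is a strict supersolution, as Δ(2 - s) = -n s and 2 - s ≤ 1 ≤
  -- s; comparison would give -v(p) ≥ 0. Taking `s₁ = 0` leaves no inner boundary.
  have hzero : IsDirichletSolution p S μ (fun x => v x - 2 * v x) := hv.sub_const_mul hv 2
  have key := nonneg_on_annulus (s₁ := 0) (Z := fun x => v x - 2 * v x) (h := fun s => 2 - s)
    hzero.cont (by fun_prop)
    (fun s _ _ hs => by linarith)
    (fun x hx => absurd (one_le_coshDist p x) (by rw [hx]; norm_num))
    (fun x hx => by rw [hzero.bdry x hx]) hzero.c2 ?_ p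
    (by rw [coshDist_self]; norm_num) (by rw [coshDist_self]; exact hS.le)
  · have := hpos p (by rw [coshDist_self]; exact hS)
    linarith
  · intro x _ hxS hx
    rw [hzero.eqn x hxS, hd]
    have h1 := one_le_coshDist p x
    have hvx := hpos x hxS
    have h2 : μ * (2 - coshDist p x) < n * coshDist p x := by
      rcases le_or_gt μ 0 with h | h
      · have h3 : (0 : ℝ) ≤ n := Nat.cast_nonneg n
        rcases h.lt_or_eq with h4 | h4
        · nlinarith
        · rw [h4] at hlt ⊢; nlinarith
      · nlinarith
    simp only [deriv_const']
    nlinarith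

/-- A nonnegative solution which is positive at the centre is positive in the whole ball. -/
theorem pos_of_pos_center (hw : IsDirichletSolution p S μ w) (hμ : 0 ≤ μ) (hS : 1 < S)
    (hnonneg : ∀ x, coshDist p x < S → 0 ≤ w x) (hp : 0 < w p) (x : Hyp n)
    (hx : coshDist p x < S) : 0 < w x := by
  obtain ⟨s₁, h₁, h₁S, hs₁⟩ : ∃ s₁, 1 < s₁ ∧ s₁ < S ∧
      ∀ y, coshDist p y ≤ s₁ → w p / 2 ≤ w y := by
    set W := {y | coshDist p y ≤ S} ∩ w ⁻¹' Iic (w p / 2)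
    have hWc : IsCompact W := by
      refine (isCompact_coshDist_le p S).of_isClosed_subset ?_ inter_subset_left
      exact hw.cont.preimage_isClosed_of_isClosed
        (isClosed_le (continuous_coshDist p) continuous_const) isClosed_Iic
    rcases W.eq_empty_or_nonempty with hW | hW
    · refine ⟨(1 + S) / 2, by linarith, by linarith, fun y hy => ?_⟩
      by_contra hlt
      push Not at hlt
      have : y ∈ W := ⟨by simp only [mem_ofPred_eq]; linarith, hlt.le⟩
      rw [hW] at this
      exact this
    · obtain ⟨y₀, hy₀, hmin⟩ := hWc.exists_isMinOn hW (continuous_coshDist p).continuousOn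
      have hne : y₀ ≠ p := by
        rintro rfl
        have : w y₀ ≤ w y₀ / 2 := hy₀.2
        linarith
      have h1 := one_lt_coshDist hne
      have h2 : coshDist p y₀ ≤ S := hy₀.1
      refine ⟨(1 + coshDist p y₀) / 2, by linarith, by linarith, fun y hy => ?_⟩
      by_contra hlt
      push Not at hlt
      have : y ∈ W := ⟨by simp only [mem_ofPred_eq]; linarith, hlt.le⟩
      have := hmin this
      simp only [mem_ofPred_eq] at this
      linarith
  rcases le_or_gt (coshDist p x) s₁ with hle | hgt
  · have := hs₁ x hle
    linarith
  -- With k this large, the barrier exp(-k s) - exp(-k S) is strictly subharmonic for s₁ < s < S,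
  -- while w is superharmonic; the barrier vanishes at s = S and is at most 1 at s = s₁, where w ≥
  -- w(p)/2.
  obtain ⟨k, hk0, hk⟩ : ∃ k : ℝ, 0 < k ∧ n * S < k * (s₁ ^ 2 - 1) := by
    have h2 : 0 < s₁ ^ 2 - 1 := by nlinarith
    refine ⟨(n * S + 1) / (s₁ ^ 2 - 1), by positivity, ?_⟩
    rw [div_mul_cancel₀ _ h2.ne']; linarith
  set b : ℝ → ℝ := fun s => Real.exp (-k * s) - Real.exp (-k * S) with hb
  have hbC : ContDiff ℝ 2 b := by fun_prop
  have hb1 : deriv b = fun s => -k * Real.exp (-k * s) := by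
    ext s
    have := (((hasDerivAt_id s).const_mul (-k)).exp).sub_const (Real.exp (-k * S))
    refine (this.congr_deriv ?_).deriv
    simp only [id]; ring
  have hb2 : deriv (deriv b) = fun s => k ^ 2 * Real.exp (-k * s) := by
    rw [hb1]
    ext s
    have := (((hasDerivAt_id s).const_mul (-k)).exp).const_mul (-k)
    refine (this.congr_deriv ?_).deriv
    simp only [id]; ring
  set ε := w p / 2 with hε
  have hε0 : 0 < ε := by rw [hε]; linarith
  have hbC2 : ∀ y, IsC2At (fun y => b (coshDist p y)) y := fun y =>
    isC2At_comp_coshDist hbC.contDiffAt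
  have key := nonneg_on_annulus (p := p) (s₁ := s₁) (S := S)
    (Z := fun y => w y - ε * b (coshDist p y)) (h := fun _ => 1)
    (hw.cont.sub ((continuous_const.mul (hbC.continuous.comp
      (continuous_coshDist p))).continuousOn)) contDiff_const (fun _ _ _ _ => one_pos)
    (fun y hy => ?_) (fun y hy => ?_) (fun y hy => (hw.c2 y hy).sub_const_mul (hbC2 y) ε)
    (fun y hy₁ hyS _ => ?_) x hgt.le hx.le
  · have h3 : 0 < b (coshDist p x) := by
      rw [hb]
      simp only [sub_pos, Real.exp_lt_exp]
      nlinarith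
    have h4 := mul_pos hε0 h3
    linarith
  · have h3 := hs₁ y hy.le
    have h4 : b (coshDist p y) ≤ 1 := by
      have h5 : Real.exp (-k * coshDist p y) ≤ 1 := by
        rw [Real.exp_le_one_iff]
        nlinarith [one_le_coshDist p y]
      have h6 := Real.exp_pos (-k * S)
      simp only [hb]; linarith
    nlinarith
  · rw [hw.bdry y hy, hy, hb]; simp
  · rw [laplaceBeltrami_sub_const_mul (hw.c2 y hyS) (hbC2 y), hw.eqn y hyS,
      laplaceBeltrami_comp_coshDist hbC.contDiffAt, hb2, hb1]
    simp only [deriv_const', deriv_const, zero_mul, mul_zero, add_zero, mul_one]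
    have h3 : 0 < k ^ 2 * Real.exp (-k * coshDist p y) * (coshDist p y ^ 2 - 1) +
        n * (-k * Real.exp (-k * coshDist p y) * coshDist p y) := by
      have h4 : k ^ 2 * Real.exp (-k * coshDist p y) * (coshDist p y ^ 2 - 1) +
        n * (-k * Real.exp (-k * coshDist p y) * coshDist p y) =
        (k * Real.exp (-k * coshDist p y)) *
          (k * (coshDist p y ^ 2 - 1) - n * coshDist p y) := by ring
      rw [h4]
      refine mul_pos (by positivity) ?_
      have h5 : k * (s₁ ^ 2 - 1) ≤ k * (coshDist p y ^ 2 - 1) := by gcongr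
      have h6 : (n : ℝ) * coshDist p y ≤ n * S := by gcongr
      linarith
    have h7 := mul_nonneg hμ (hnonneg y hyS)
    have h8 := mul_pos hε0 h3
    linarith

/-- A solution that is positive in the ball dominates a small multiple of any other solution. -/
theorem exists_const_mul_le (hw : IsDirichletSolution p S μ w) (hu : IsDirichletSolution p S μ u)
    (hμ : 0 ≤ μ) (hS : 1 < S) (hpos : ∀ x, coshDist p x < S → 0 < w x) :
    ∃ ε > 0, ∀ x, coshDist p x < S → ε * u x ≤ w x := by
  set a := S - 1 with ha
  have ha0 : 0 < a := sub_pos.2 hS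
  -- In a thin shell h = 1 - K (S - s)² satisfies Δh < -μ h, so no Hopf lemma is needed there. The
  -- conditions on δ give s² - 1 ≥ a, make the first-order term of Δh at most K a, so that Δh ≤ -(μ
  -- + 1), and keep h positive.
  set K := (μ + 1) / a with hK
  have hK0 : 0 < K := by positivity
  have hKa : K * a = μ + 1 := div_mul_cancel₀ _ ha0.ne'
  obtain ⟨δ, hδ0, hδ1, hδ2, hδ3⟩ :
      ∃ δ : ℝ, 0 < δ ∧ δ < a / 2 ∧ n * δ * S < a / 2 ∧ K * δ ^ 2 < 1 := by
    have h1 : ∀ᶠ δ : ℝ in 𝓝[>] 0, δ < a / 2 :=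
      ((continuous_id (X := ℝ)).tendsto 0).eventually_lt_const (u := a / 2) (by simpa using ha0)
        |>.filter_mono nhdsWithin_le_nhds
    have h2 : ∀ᶠ δ : ℝ in 𝓝[>] 0, n * δ * S < a / 2 :=
      ((show Continuous fun δ : ℝ => n * δ * S by fun_prop).tendsto 0).eventually_lt_const
        (u := a / 2) (by simpa using ha0) |>.filter_mono nhdsWithin_le_nhds
    have h3 : ∀ᶠ δ : ℝ in 𝓝[>] 0, K * δ ^ 2 < 1 :=
      ((show Continuous fun δ : ℝ => K * δ ^ 2 by fun_prop).tendsto 0).eventually_lt_const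
        (u := 1) (by simp) |>.filter_mono nhdsWithin_le_nhds
    obtain ⟨δ, h⟩ := (h1.and (h2.and (h3.and self_mem_nhdsWithin))).exists
    exact ⟨δ, h.2.2.2, h.1, h.2.1, h.2.2.1⟩
  have hcpt := isCompact_coshDist_le p (S - δ)
  have hsub : {x | coshDist p x ≤ S - δ} ⊆ {x | coshDist p x ≤ S} := fun x hx => by
    simp only [mem_ofPred_eq] at hx ⊢; linarith
  have hne : {x | coshDist p x ≤ S - δ}.Nonempty := ⟨p, by
    simp only [mem_ofPred_eq, coshDist_self]; linarith⟩
  obtain ⟨y₁, hy₁, hmin⟩ := hcpt.exists_isMinOn hne (hw.cont.mono hsub)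
  obtain ⟨y₂, hy₂, hmax⟩ := hcpt.exists_isMaxOn hne (hu.cont.mono hsub)
  have hc : 0 < w y₁ := hpos y₁ (by simp only [mem_ofPred_eq] at hy₁; linarith)
  set ε := w y₁ / (|u y₂| + 1) with hε
  have hM : 0 < |u y₂| + 1 := by positivity
  have hε0 : 0 < ε := div_pos hc hM
  have hinner : ∀ x, coshDist p x ≤ S - δ → 0 ≤ w x - ε * u x := by
    intro x hx
    have h1 : w y₁ ≤ w x := hmin hx
    have h2 : u x ≤ u y₂ := hmax hx
    have h3 : ε * (|u y₂| + 1) = w y₁ := div_mul_cancel₀ _ hM.ne'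
    have h4 := le_abs_self (u y₂)
    nlinarith
  refine ⟨ε, hε0, fun x hx => ?_⟩
  rw [← sub_nonneg]
  rcases le_or_gt (coshDist p x) (S - δ) with hle | hgt
  · exact hinner x hle
  have hz := hw.sub_const_mul hu ε
  have hd1 : deriv (fun s : ℝ => 1 - K * (S - s) ^ 2) = fun s => 2 * K * (S - s) := by
    ext s
    have := ((((hasDerivAt_id s).const_sub S).pow 2).const_mul K).const_sub 1
    refine (this.congr_deriv ?_).deriv
    simp only [id]; ring
  have hd2 : deriv (fun s : ℝ => 2 * K * (S - s)) = fun _ => -(2 * K) := by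
    ext s
    refine ((((hasDerivAt_id s).const_sub S).const_mul (2 * K)).congr_deriv ?_).deriv
    ring
  refine nonneg_on_annulus (s₁ := S - δ) (h := fun s => 1 - K * (S - s) ^ 2) hz.cont
    (by fun_prop) (fun s _ hs hsS => ?_) (fun y hy => hinner y hy.le)
    (fun y hy => (hz.bdry y hy).ge) hz.c2 (fun y hyδ hyS hy => ?_) x hgt.le hx.le
  · have : (S - s) ^ 2 ≤ δ ^ 2 := by
      apply pow_le_pow_left₀ <;> linarith
    nlinarith
  · rw [hz.eqn y hyS, hd1, hd2]
    set s := coshDist p y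
    have h1 : 1 - K * (S - s) ^ 2 ≤ 1 := by
      have := mul_nonneg hK0.le (sq_nonneg (S - s)); linarith
    have h2 : a ≤ s ^ 2 - 1 := by nlinarith
    have h3 : (n : ℝ) * (S - s) * s ≤ n * δ * S := by
      gcongr <;> linarith
    have h4 : -(2 * K) * (s ^ 2 - 1) + n * (2 * K * (S - s) * s) < -μ := by
      have : K * (n * (S - s) * s) ≤ K * (a / 2) := by gcongr; linarith
      have : K * a ≤ K * (s ^ 2 - 1) := by gcongr
      nlinarith
    have h5 : μ * (1 - K * (S - s) ^ 2) ≤ μ := by nlinarith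
    have h6 : -(2 * K) * (s ^ 2 - 1) + n * (2 * K * (S - s) * s) <
      -μ * (1 - K * (S - s) ^ 2) := by linarith
    have h7 := mul_lt_mul_of_neg_left h6 hy
    linarith

/-- Positive solutions with the same value at the centre are comparable. By symmetry of the
hypotheses, they are equal in the ball. -/
theorem le_of_center_eq (hv : IsDirichletSolution p S μ v) (hu : IsDirichletSolution p S μ u)
    (hμ : 0 ≤ μ) (hS : 1 < S) (hvpos : ∀ x, coshDist p x < S → 0 < v x)
    (hupos : ∀ x, coshDist p x < S → 0 < u x) (huv : u p = v p) (x : Hyp n)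
    (hx : coshDist p x < S) : u x ≤ v x := by
  have hpS : coshDist p p < S := by rwa [coshDist_self]
  -- Equality at the centre bounds T by 1. If its maximum t were below 1, v - t u would be positive
  -- and dominate some ε u, so t + ε would lie in T.
  set T := {t : ℝ | ∀ x, coshDist p x < S → t * u x ≤ v x} with hT
  have hT0 : (0 : ℝ) ∈ T := fun y hy => by rw [zero_mul]; exact (hvpos y hy).le
  have hTb : BddAbove T := ⟨1, fun t ht => by
    have h1 := ht p hpS
    have h2 := hvpos p hpS
    rw [huv] at h1
    by_contra hlt
    push Not at hlt
    nlinarith⟩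
  have hmem : sSup T ∈ T := by
    refine IsClosed.csSup_mem ?_ ⟨0, hT0⟩ hTb
    simp only [hT, ofPred_forall]
    refine isClosed_iInter fun y => isClosed_iInter fun _ => ?_
    exact isClosed_le (by fun_prop) continuous_const
  set t := sSup T with ht
  have h1 : 1 ≤ t := by
    by_contra hlt
    push Not at hlt
    have hw := hv.sub_const_mul hu t
    have hwpos := hw.pos_of_pos_center hμ hS (fun y hy => by linarith [hmem y hy]) (by
      rw [huv]
      have := hvpos p hpS
      nlinarith)
    obtain ⟨ε, hε, hle⟩ := hw.exists_const_mul_le hu hμ hS hwpos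
    have : t + ε ∈ T := fun y hy => by linarith [hle y hy]
    have := le_csSup hTb this
    linarith
  have h2 := hmem x hx
  have h3 := hupos x hx
  nlinarith

/-- A positive solution is radial. -/
theorem eq_of_coshDist_eq (hv : IsDirichletSolution p S μ v) (hμ : 0 ≤ μ) (hS : 1 < S)
    (hpos : ∀ x, coshDist p x < S → 0 < v x) {x y : Hyp n} (hxy : coshDist p x = coshDist p y)
    (hx : coshDist p x < S) : v x = v y := by
  obtain ⟨N, hp, h1, h2⟩ := exists_hypReflection hxy
  have hu := hv.comp_hypReflection hp
  have hle := hv.le_of_center_eq hu hμ hS hpos (fun z hz => hpos _ (by rwa [coshDist_hypReflection]))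
    (by rw [hypReflection_center])
  refine le_antisymm ?_ ?_
  · have := hle y (hxy ▸ hx)
    rwa [h2] at this
  · have := hle x hx
    rwa [h1] at this

end IsDirichletSolution

/-! ### The Riccati equation for the logarithmic derivative -/

theorem continuousAt_deriv_deriv {f : ℝ → ℝ} {t : ℝ} (hf : ContDiffAt ℝ 2 f t) :
    ContinuousAt (deriv (deriv f)) t :=
  (((contDiffAt_deriv hf).fderiv_right (m := 0) (by norm_num)).clm_apply
    contDiffAt_const).continuousAt

/-- A function with `φ(0) = 0` and `φ < φ'` is positive. -/
theorem pos_of_lt_deriv {φ D : ℝ → ℝ} {a : ℝ} (ha : 0 < a) (h0 : φ 0 = 0)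
    (hφ : ∀ ρ ∈ Icc 0 a, HasDerivAt φ (D ρ) ρ) (h : ∀ ρ ∈ Ioo 0 a, φ ρ < D ρ) : 0 < φ a := by
  have hd : ∀ ρ ∈ Icc 0 a, HasDerivAt (fun ρ => φ ρ * Real.exp (-ρ))
      ((D ρ - φ ρ) * Real.exp (-ρ)) ρ := by
    intro ρ hρ
    refine ((hφ ρ hρ).mul ((hasDerivAt_neg ρ).exp)).congr_deriv ?_
    ring
  have hmono : StrictMonoOn (fun ρ => φ ρ * Real.exp (-ρ)) (Icc 0 a) := by
    refine strictMonoOn_of_deriv_pos (convex_Icc 0 a)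
      (fun ρ hρ => (hd ρ hρ).continuousAt.continuousWithinAt) fun ρ hρ => ?_
    rw [interior_Icc] at hρ
    rw [(hd ρ (Ioo_subset_Icc_self hρ)).deriv]
    exact mul_pos (sub_pos.2 (h ρ hρ)) (Real.exp_pos _)
  have := hmono (left_mem_Icc.2 ha.le) (right_mem_Icc.2 ha.le) ha
  simp only [h0, zero_mul] at this
  exact pos_of_mul_pos_left this (Real.exp_pos _).le

/-- The Riccati equation `φ' = μ + φ² - m coth φ`, with `φ(0) = 0`, on a short interval:
the solution satisfies `φ < φ'`. -/
theorem riccati_lt_deriv {φ D : ℝ → ℝ} {m μ r : ℝ} (hm : m = 0 ∨ 1 ≤ m) (hμ : 1 ≤ μ)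
    (hr : Real.sinh r ≤ 1 / 2) (h0 : φ 0 = 0) (hD0 : 0 < D 0)
    (hφ : ∀ ρ ∈ Ico 0 r, HasDerivAt φ (D ρ) ρ) (hDc : ∀ ρ ∈ Ico 0 r, ContinuousAt D ρ)
    (hD : ∀ ρ ∈ Ioo 0 r, D ρ = μ + φ ρ ^ 2 - m * (Real.cosh ρ / Real.sinh ρ) * φ ρ)
    {ρ₀ : ℝ} (hρ₀ : ρ₀ ∈ Ioo 0 r) : φ ρ₀ < D ρ₀ := by
  rcases hm with rfl | hm
  · rw [hD ρ₀ hρ₀]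
    nlinarith [sq_nonneg (φ ρ₀ - 1)]
  by_contra hneg
  push Not at hneg
  have hIcc : ∀ ρ ∈ Icc 0 ρ₀, ρ ∈ Ico 0 r := fun ρ hρ => ⟨hρ.1, hρ.2.trans_lt hρ₀.2⟩
  have hgc : ∀ ρ ∈ Ico 0 r, ContinuousAt (fun ρ => D ρ - φ ρ) ρ := fun ρ hρ =>
    (hDc ρ hρ).sub (hφ ρ hρ).continuousAt
  -- The least element ρ₁ of A is the first point where D ≤ φ; it is positive because φ(0) = 0 <
  -- D(0), and equality holds there by continuity.
  set A := Icc 0 ρ₀ ∩ (fun ρ => D ρ - φ ρ) ⁻¹' Iic 0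
  have hA : IsCompact A := by
    refine isCompact_Icc.of_isClosed_subset ?_ inter_subset_left
    refine ContinuousOn.preimage_isClosed_of_isClosed (fun ρ hρ => ?_) isClosed_Icc isClosed_Iic
    exact (hgc ρ (hIcc ρ hρ)).continuousWithinAt
  obtain ⟨ρ₁, hρ₁, hmin⟩ := hA.exists_isMinOn
    ⟨ρ₀, ⟨hρ₀.1.le, le_rfl⟩, sub_nonpos.2 hneg⟩ continuousOn_id
  have hle : D ρ₁ - φ ρ₁ ≤ 0 := hρ₁.2
  have hpos₁ : 0 < ρ₁ := by
    refine lt_of_le_of_ne hρ₁.1.1 fun h => ?_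
    rw [← h, h0] at hle
    linarith
  have hρ₁r : ρ₁ < r := hρ₁.1.2.trans_lt hρ₀.2
  have hlt : ∀ ρ, 0 ≤ ρ → ρ < ρ₁ → φ ρ < D ρ := by
    intro ρ h1 h2
    by_contra hcon
    push Not at hcon
    have h3 : ρ ∈ A := ⟨⟨h1, h2.le.trans hρ₁.1.2⟩, sub_nonpos.2 hcon⟩
    exact (hmin h3).not_gt h2
  have hleft : ∀ᶠ ρ in 𝓝[<] ρ₁, 0 < D ρ - φ ρ := by
    filter_upwards [Ioo_mem_nhdsLT hpos₁] with ρ hρ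
    exact sub_pos.2 (hlt ρ hρ.1.le hρ.2)
  have heq : D ρ₁ = φ ρ₁ := by
    refine le_antisymm (sub_nonpos.1 hle) (sub_nonneg.1 ?_)
    have ht : Tendsto (fun ρ => D ρ - φ ρ) (𝓝[<] ρ₁) (𝓝 (D ρ₁ - φ ρ₁)) :=
      (hgc ρ₁ ⟨hpos₁.le, hρ₁r⟩).tendsto.mono_left nhdsWithin_le_nhds
    refine ge_of_tendsto ht ?_
    filter_upwards [hleft] with ρ hρ using hρ.le
  have hφpos : 0 < φ ρ₁ := pos_of_lt_deriv hpos₁ h0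
    (fun ρ hρ => hφ ρ ⟨hρ.1, hρ.2.trans_lt hρ₁r⟩) fun ρ hρ => hlt ρ hρ.1.le hρ.2
  have hσ : 0 < Real.sinh ρ₁ := Real.sinh_pos_iff.2 hpos₁
  have hσ2 : Real.sinh ρ₁ ≤ 1 / 2 := (Real.sinh_le_sinh.2 hρ₁r.le).trans hr
  have hC := Real.cosh_sq ρ₁
  have hd1 := hφ ρ₁ ⟨hpos₁.le, hρ₁r⟩
  have hcoth : HasDerivAt (fun ρ => Real.cosh ρ / Real.sinh ρ) (-(1 / Real.sinh ρ₁ ^ 2)) ρ₁ := by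
    refine ((Real.hasDerivAt_cosh ρ₁).div (Real.hasDerivAt_sinh ρ₁) hσ.ne').congr_deriv ?_
    field_simp
    linarith
  -- D is only assumed continuous; the equation itself makes it differentiable at ρ₁, and D = φ
  -- there simplifies the result.
  have hg : HasDerivAt (fun ρ => D ρ - φ ρ) (φ ρ₁ * (2 * φ ρ₁ +
      m * (1 / Real.sinh ρ₁ ^ 2 - Real.cosh ρ₁ / Real.sinh ρ₁) - 1)) ρ₁ := by
    have h1 := (((hd1.pow 2).const_add μ).sub ((hcoth.const_mul m).mul hd1)).sub hd1
    have h2 : (fun ρ => D ρ - φ ρ) =ᶠ[𝓝 ρ₁]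
        fun ρ => μ + φ ρ ^ 2 - m * (Real.cosh ρ / Real.sinh ρ) * φ ρ - φ ρ := by
      filter_upwards [Ioo_mem_nhds hpos₁ hρ₁r] with ρ hρ
      rw [hD ρ hρ]
    refine (HasDerivAt.congr_of_eventuallyEq h1 h2).congr_deriv ?_
    rw [heq]
    ring
  have hcosh : Real.cosh ρ₁ ≤ 6 / 5 := by
    refine le_of_sq_le_sq ?_ (by norm_num)
    rw [hC]; nlinarith
  -- This is cosh · sinh + sinh² < 1; with sinh ≤ 1/2 and cosh ≤ 6/5 the left side is at most 0.85.
  -- Together with m ≥ 1 it makes D - φ increase through its zero, impossible after positive values.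
  have hkey : 1 < 1 / Real.sinh ρ₁ ^ 2 - Real.cosh ρ₁ / Real.sinh ρ₁ := by
    rw [show 1 / Real.sinh ρ₁ ^ 2 - Real.cosh ρ₁ / Real.sinh ρ₁ =
      (1 - Real.cosh ρ₁ * Real.sinh ρ₁) / Real.sinh ρ₁ ^ 2 by field_simp,
      lt_div_iff₀ (by positivity)]
    nlinarith
  have hgpos : 0 < φ ρ₁ * (2 * φ ρ₁ +
      m * (1 / Real.sinh ρ₁ ^ 2 - Real.cosh ρ₁ / Real.sinh ρ₁) - 1) := by
    refine mul_pos hφpos ?_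
    nlinarith
  have hslope := (hasDerivAt_iff_tendsto_slope.1 hg).eventually_const_lt hgpos
  have hslope' : ∀ᶠ t in 𝓝[<] ρ₁, 0 < slope (fun ρ => D ρ - φ ρ) ρ₁ t :=
    hslope.filter_mono (nhdsWithin_mono ρ₁ (fun t (ht : t < ρ₁) => ht.ne))
  obtain ⟨ρ, h1, h2, h3⟩ := (hslope'.and (hleft.and self_mem_nhdsWithin)).exists
  rw [slope_def_field, heq, sub_self, sub_zero] at h1
  exact (div_neg_of_pos_of_neg h2 (sub_neg.2 h3)).not_gt h1

/-- The logarithm of the radial profile of the eigenfunction. -/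
theorem log_profile {f : ℝ → ℝ} {n : ℕ} {μ r : ℝ} (hn : 1 ≤ n) (hr0 : 0 < r)
    (hr : Real.sinh r ≤ 1 / 2) (hμ : (n : ℝ) ≤ μ)
    (hf : ∀ ρ, |ρ| < r → ContDiffAt ℝ 2 f ρ) (hpos : ∀ ρ, |ρ| < r → 0 < f ρ)
    (h0 : deriv f 0 = 0) (h00 : n * deriv (deriv f) 0 = -μ * f 0)
    (hode : ∀ ρ ∈ Ioo 0 r, deriv (deriv f) ρ +
      (n - 1) * (Real.cosh ρ / Real.sinh ρ) * deriv f ρ = -μ * f ρ) :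
    deriv (fun ρ => Real.log (f ρ)) 0 = 0 ∧ deriv (deriv fun ρ => Real.log (f ρ)) 0 < 0 ∧
      ∀ ρ ∈ Ioo 0 r, deriv (fun ρ => Real.log (f ρ)) ρ < 0 ∧
        deriv (deriv fun ρ => Real.log (f ρ)) ρ < deriv (fun ρ => Real.log (f ρ)) ρ := by
  have hn' : (1 : ℝ) ≤ n := by exact_mod_cast hn
  set ℓ : ℝ → ℝ := fun ρ => Real.log (f ρ) with hℓ
  have hℓC : ∀ ρ, |ρ| < r → ContDiffAt ℝ 2 ℓ ρ := fun ρ hρ => (hf ρ hρ).log (hpos ρ hρ).ne'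
  have hℓ1 : ∀ ρ, |ρ| < r → deriv ℓ ρ = deriv f ρ / f ρ := fun ρ hρ =>
    ((((hf ρ hρ).differentiableAt (by norm_num)).hasDerivAt).log (hpos ρ hρ).ne').deriv
  have hℓ2 : ∀ ρ, |ρ| < r → deriv (deriv ℓ) ρ = deriv (deriv f) ρ / f ρ - deriv ℓ ρ ^ 2 := by
    intro ρ hρ
    have h1 : deriv ℓ =ᶠ[𝓝 ρ] fun ρ => deriv f ρ / f ρ := by
      filter_upwards [(isOpen_lt continuous_abs continuous_const).mem_nhds hρ] with t ht
      exact hℓ1 t ht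
    have hfp := (hpos ρ hρ).ne'
    rw [h1.deriv_eq, hℓ1 ρ hρ]
    refine ((((contDiffAt_deriv (hf ρ hρ)).differentiableAt (by norm_num)).hasDerivAt.div
      ((hf ρ hρ).differentiableAt (by norm_num)).hasDerivAt hfp).congr_deriv ?_).deriv
    field_simp
  have habs : ∀ ρ ∈ Ico 0 r, |ρ| < r := fun ρ hρ => by rw [abs_of_nonneg hρ.1]; exact hρ.2
  have hz : |(0 : ℝ)| < r := by rwa [abs_zero]
  have hf0 := hpos 0 hz
  have hℓ0 : deriv ℓ 0 = 0 := by rw [hℓ1 0 hz, h0, zero_div]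
  have hℓ00 : deriv (deriv ℓ) 0 < 0 := by
    rw [hℓ2 0 hz, hℓ0]
    have : deriv (deriv f) 0 < 0 := by
      by_contra hcon
      push Not at hcon
      nlinarith
    have := div_neg_of_neg_of_pos this hf0
    linarith
  have hφ : ∀ ρ ∈ Ico 0 r, HasDerivAt (fun ρ => -deriv ℓ ρ) (-deriv (deriv ℓ) ρ) ρ := fun ρ hρ =>
    ((contDiffAt_deriv (hℓC ρ (habs ρ hρ))).differentiableAt (by norm_num)).hasDerivAt.neg
  have hlt : ∀ ρ ∈ Ioo 0 r, -deriv ℓ ρ < -deriv (deriv ℓ) ρ := by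
    intro ρ hρ
    refine riccati_lt_deriv (φ := fun ρ => -deriv ℓ ρ) (D := fun ρ => -deriv (deriv ℓ) ρ)
      (m := n - 1) (μ := μ) ?_ (hn'.trans hμ) hr (by simp [hℓ0]) (by linarith) hφ
      (fun ρ hρ => (continuousAt_deriv_deriv (hℓC ρ (habs ρ hρ))).neg) (fun ρ hρ => ?_) hρ
    -- Integrality of n excludes 0 < n - 1 < 1, where the Riccati lemma does not apply.
    · rcases hn.eq_or_lt with h | h
      · left; rw [← h]; simp
      · right
        have : (2 : ℝ) ≤ n := by exact_mod_cast h
        linarith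
    · have hρ' := habs ρ (Ioo_subset_Ico_self hρ)
      have hfp := (hpos ρ hρ').ne'
      have hs := (Real.sinh_pos_iff.2 hρ.1).ne'
      have h1 := hode ρ hρ
      have h2 : deriv f ρ = deriv ℓ ρ * f ρ := by rw [hℓ1 ρ hρ']; field_simp
      have h3 : deriv (deriv f) ρ / f ρ =
          -μ - (n - 1) * (Real.cosh ρ / Real.sinh ρ) * deriv ℓ ρ := by
        rw [div_eq_iff hfp]
        rw [h2] at h1
        linear_combination h1
      simp only [hℓ2 ρ hρ', h3]
      ring
  refine ⟨hℓ0, hℓ00, fun ρ hρ => ⟨?_, by linarith [hlt ρ hρ]⟩⟩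
  have := pos_of_lt_deriv (φ := fun ρ => -deriv ℓ ρ) (D := fun ρ => -deriv (deriv ℓ) ρ) hρ.1
    (by simp [hℓ0]) (fun t ht => hφ t ⟨ht.1, ht.2.trans_lt hρ.2⟩)
    fun t ht => hlt t ⟨ht.1, ht.2.trans hρ.2⟩
  linarith

/-! ### Functions with a radial profile -/

theorem eventuallyEq_comp_hexp {F G : Hyp n → ℝ} {x : Hyp n} (h : F =ᶠ[𝓝 x] G)
    (X : tangentSpace x) :
    (fun t : ℝ => F (hexp x (t • X))) =ᶠ[𝓝 0] fun t => G (hexp x (t • X)) := by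
  have hc := (continuous_hexp X).tendsto 0
  rw [hexp_zero_smul] at hc
  exact hc.eventually h

/-- `F = k(d(p, ·))` on the ball `cosh d(p, ·) < S`, for an even function `k`. -/
def HasRadialProfile (p : Hyp n) (S : ℝ) (F : Hyp n → ℝ) (k : ℝ → ℝ) : Prop :=
  ∀ x ρ, coshDist p x < S → Real.cosh ρ = coshDist p x → F x = k ρ

namespace HasRadialProfile

variable {p : Hyp n} {S : ℝ} {F : Hyp n → ℝ} {k : ℝ → ℝ}

theorem comp_hexp_center (h : HasRadialProfile p S F k) (hS : 1 < S) (X : tangentSpace p) :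
    (fun t : ℝ => F (hexp p (t • X))) =ᶠ[𝓝 0] fun t => k (t * tlen X) := by
  have hc : ∀ᶠ t : ℝ in 𝓝 0, coshDist p (hexp p (t • X)) < S := by
    have := (((continuous_coshDist p).comp (continuous_hexp X)).tendsto 0)
    refine this.eventually_lt_const ?_
    simpa only [Function.comp, hexp_zero_smul, coshDist_self] using hS
  filter_upwards [hc] with t ht
  exact h _ _ ht (coshDist_hexp_self t X).symm

/-- The centre is treated along geodesics, because arcosh is not smooth at 1 and the passage to a
function of cosh d fails there. -/
theorem hessQuad_center (h : HasRadialProfile p S F k) (hS : 1 < S) (hk : ContDiffAt ℝ 2 k 0)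
    (X : tangentSpace p) : hessQuad F p X = deriv (deriv k) 0 * mink X.1 X.1 := by
  rw [hessQuad, (h.comp_hexp_center hS X).iteratedDeriv_eq]
  have := iteratedDeriv_two_comp_curve_real (g := k) (c := fun t => t * tlen X)
    (c' := fun _ => tlen X) (t := 0) (by simpa using hk)
    (fun t => by simpa using (hasDerivAt_id t).mul_const (tlen X)) (hasDerivAt_const 0 _)
  rw [this, ← tlen_sq]
  simp

theorem dirDeriv_center (h : HasRadialProfile p S F k) (hS : 1 < S) (hk : ContDiffAt ℝ 2 k 0)
    (X : tangentSpace p) : dirDeriv F p X = deriv k 0 * tlen X := by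
  rw [dirDeriv, (h.comp_hexp_center hS X).deriv_eq]
  have h1 : HasDerivAt k (deriv k 0) (0 * tlen X) := by
    rw [zero_mul]; exact (hk.differentiableAt (by norm_num)).hasDerivAt
  have h2 : HasDerivAt (fun t => t * tlen X) (tlen X) 0 := by
    simpa using (hasDerivAt_id (0 : ℝ)).mul_const (tlen X)
  exact (h1.comp (0 : ℝ) h2).deriv

/-- Away from the centre, `F` is a `C²` function of `cosh d(p, ·)`. -/
theorem exists_comp_coshDist (h : HasRadialProfile p S F k) {x : Hyp n} (hx : coshDist p x < S)
    {ρ : ℝ} (hρ : 0 < ρ) (hxρ : Real.cosh ρ = coshDist p x) (hk : ContDiffAt ℝ 2 k ρ) :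
    ∃ G : ℝ → ℝ, ContDiffAt ℝ 2 G (coshDist p x) ∧ F =ᶠ[𝓝 x] (fun y => G (coshDist p y)) ∧
      deriv G (coshDist p x) * Real.sinh ρ = deriv k ρ ∧
      deriv (deriv G) (coshDist p x) * Real.sinh ρ ^ 2 + deriv G (coshDist p x) * coshDist p x =
        deriv (deriv k) ρ := by
  have h1 : 1 < coshDist p x := by rw [← hxρ]; exact Real.one_lt_cosh.2 hρ.ne'
  have harc : Real.arcosh (coshDist p x) = ρ := by rw [← hxρ, Real.arcosh_cosh hρ.le]
  set G : ℝ → ℝ := fun s => k (Real.arcosh s) with hG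
  have hGC : ContDiffAt ℝ 2 G (coshDist p x) :=
    ContDiffAt.comp _ (by rwa [harc]) (Real.contDiffAt_arcosh h1)
  have hkG : (fun ρ => G (Real.cosh ρ)) =ᶠ[𝓝 ρ] k := by
    filter_upwards [lt_mem_nhds hρ] with t ht
    rw [hG]
    simp only [Real.arcosh_cosh ht.le]
  refine ⟨G, hGC, ?_, ?_, ?_⟩
  · filter_upwards [(continuous_coshDist p).continuousAt.eventually (gt_mem_nhds hx)] with y hy
    exact h y _ hy (Real.cosh_arcosh (one_le_coshDist p y))
  · rw [← hkG.deriv_eq, ← hxρ]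
    have hd : HasDerivAt G (deriv G (Real.cosh ρ)) (Real.cosh ρ) := by
      rw [hxρ]; exact (hGC.differentiableAt (by norm_num)).hasDerivAt
    exact (hd.comp ρ (Real.hasDerivAt_cosh ρ)).deriv.symm
  · have h2 := hkG.iteratedDeriv_eq 2
    rw [iteratedDeriv_two_comp_curve_real (c := Real.cosh) (by rwa [hxρ]) Real.hasDerivAt_cosh
      (Real.hasDerivAt_sinh ρ), iteratedDeriv_succ, iteratedDeriv_one] at h2
    rw [← h2, hxρ]

end HasRadialProfile

/-! ### Radial Hessians as rank-one perturbations of scalar matrices -/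

theorem hessMatrix_eq {F : Hyp n → ℝ} {p x : Hyp n} {a b : ℝ}
    (h : ∀ X, hessQuad F x X = a * mink p.1 X.1 ^ 2 + b * mink X.1 X.1) :
    hessMatrix F x = Matrix.of fun i j => a * (mink p.1 (frame x i).1 * mink p.1 (frame x j).1) +
      b * (1 : Matrix (Fin n) (Fin n) ℝ) i j := by
  ext i j
  simp only [hessMatrix, Matrix.of_apply, hess, h, Matrix.one_apply, ← frame_orthonormal x i j]
  change (a * mink p.1 ((frame x i).1 + (frame x j).1) ^ 2 + b * mink ((frame x i).1 + (frame x j).1)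
    ((frame x i).1 + (frame x j).1) - (a * mink p.1 ((frame x i).1 - (frame x j).1) ^ 2 +
    b * mink ((frame x i).1 - (frame x j).1) ((frame x i).1 - (frame x j).1))) / 4 = _
  simp only [mink_add_left, mink_add_right, mink_sub_left, mink_sub_right,
    mink_comm (frame x j).1 (frame x i).1]
  ring

/-- The matrix a P Pᵀ + b has eigenvalues b orthogonally to P and a |P|² + b along P. If a ≤ 0 the
rank-one term helps; if a > 0, Cauchy–Schwarz bounds it by the value along P. -/
theorem posDef_of_rank_one {P : Fin n → ℝ} {a b c : ℝ} (h1 : b + c < 0)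
    (h2 : a * ∑ i, P i ^ 2 + b + c < 0) :
    Matrix.PosDef (-(Matrix.of fun i j => a * (P i * P j) + b * (1 : Matrix (Fin n) (Fin n) ℝ) i j)
      - c • (1 : Matrix (Fin n) (Fin n) ℝ)) := by
  have hM : -(Matrix.of fun i j => a * (P i * P j) + b * (1 : Matrix (Fin n) (Fin n) ℝ) i j)
      - c • (1 : Matrix (Fin n) (Fin n) ℝ) =
      (-a) • Matrix.vecMulVec P P + (-(b + c)) • (1 : Matrix (Fin n) (Fin n) ℝ) := by
    ext i j
    simp only [Matrix.sub_apply, Matrix.neg_apply, Matrix.of_apply, Matrix.smul_apply,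
      Matrix.add_apply, Matrix.vecMulVec_apply, smul_eq_mul]
    ring
  rw [hM]
  refine Matrix.PosDef.of_dotProduct_mulVec_pos ?_ fun ξ hξ => ?_
  · ext i j
    simp only [Matrix.conjTranspose_apply, Matrix.add_apply, Matrix.smul_apply,
      Matrix.vecMulVec_apply, Matrix.one_apply, star_trivial, smul_eq_mul, eq_comm (a := j)]
    ring
  · have hq : star ξ ⬝ᵥ ((-a) • Matrix.vecMulVec P P +
        (-(b + c)) • (1 : Matrix (Fin n) (Fin n) ℝ)).mulVec ξ =
        -a * (∑ i, P i * ξ i) ^ 2 - (b + c) * ∑ i, ξ i ^ 2 := by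
      rw [Matrix.add_mulVec, Matrix.smul_mulVec, Matrix.smul_mulVec, Matrix.one_mulVec,
        Matrix.vecMulVec_mulVec]
      simp only [dotProduct, star_trivial, Pi.add_apply, Pi.smul_apply, smul_eq_mul,
        MulOpposite.smul_eq_mul_unop, MulOpposite.unop_op, mul_add, Finset.sum_add_distrib]
      have e1 : ∑ i, ξ i * (-a * (P i * ∑ j, P j * ξ j)) = -a * (∑ i, P i * ξ i) ^ 2 := by
        rw [pow_two, ← mul_assoc, Finset.mul_sum Finset.univ (fun i => P i * ξ i) (_ * _)]
        exact Finset.sum_congr rfl fun i _ => by ring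
      have e2 : ∑ i, ξ i * (-(b + c) * ξ i) = -(b + c) * ∑ i, ξ i ^ 2 := by
        rw [Finset.mul_sum]
        exact Finset.sum_congr rfl fun i _ => by ring
      rw [e1, e2]; ring
    rw [hq]
    have hpos : 0 < ∑ i, ξ i ^ 2 := by
      obtain ⟨i, hi⟩ := Function.ne_iff.1 hξ
      have hi : ξ i ≠ 0 := hi
      exact Finset.sum_pos' (fun j _ => sq_nonneg _) ⟨i, Finset.mem_univ i, by positivity⟩
    have hCS := Finset.sum_mul_sq_le_sq_mul_sq Finset.univ P ξ
    rcases le_or_gt a 0 with ha | ha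
    · have := mul_nonneg (neg_nonneg.2 ha) (sq_nonneg (∑ i, P i * ξ i))
      nlinarith
    · have := mul_le_mul_of_nonneg_left hCS ha.le
      nlinarith

/-! ### The profile of the eigenfunction and the conclusion -/

namespace IsDirichletSolution

variable {p : Hyp n} {r μ : ℝ} {v : Hyp n → ℝ}

/-- The profile of a positive solution along a geodesic from the centre, and its equation. -/
theorem exists_profile (hv : IsDirichletSolution p (Real.cosh r) μ v) (hn : 1 ≤ n) (hr : 0 < r)
    (hμ : 0 ≤ μ) (hpos : ∀ x, coshDist p x < Real.cosh r → 0 < v x) :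
    ∃ f : ℝ → ℝ, HasRadialProfile p (Real.cosh r) v f ∧ (∀ ρ, |ρ| < r → ContDiffAt ℝ 2 f ρ) ∧
      (∀ ρ, |ρ| < r → 0 < f ρ) ∧ deriv f 0 = 0 ∧ n * deriv (deriv f) 0 = -μ * f 0 ∧
      ∀ ρ ∈ Ioo 0 r, deriv (deriv f) ρ +
        (n - 1) * (Real.cosh ρ / Real.sinh ρ) * deriv f ρ = -μ * f ρ := by
  have hS : 1 < Real.cosh r := Real.one_lt_cosh.2 hr.ne'
  set E : tangentSpace p := frame p ⟨0, hn⟩ with hE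
  have hE1 : tlen E = 1 := by rw [tlen, hE, frame_orthonormal]; simp
  have hcd : ∀ ρ : ℝ, coshDist p (hexp p (ρ • E)) = Real.cosh ρ := fun ρ => by
    rw [coshDist_hexp_self, hE1, mul_one]
  have hlt : ∀ ρ, |ρ| < r → coshDist p (hexp p (ρ • E)) < Real.cosh r := fun ρ hρ => by
    rw [hcd, Real.cosh_lt_cosh, abs_of_pos hr]; exact hρ
  set f : ℝ → ℝ := fun ρ => v (hexp p (ρ • E)) with hf
  have hprof : HasRadialProfile p (Real.cosh r) v f := fun x ρ hx hρ =>
    hv.eq_of_coshDist_eq hμ hS hpos (by rw [hcd, hρ]) hx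
  have hfC : ∀ ρ, |ρ| < r → ContDiffAt ℝ 2 f ρ := fun ρ hρ =>
    contDiffAt_along_geodesic E (hv.c2 _ (hlt ρ hρ))
  have h0r : |(0 : ℝ)| < r := by rwa [abs_zero]
  have hpS : coshDist p p < Real.cosh r := by rwa [coshDist_self]
  have hf0 : f 0 = v p := by rw [hf]; simp only [hexp_zero_smul]
  refine ⟨f, hprof, hfC, fun ρ hρ => hpos _ (hlt ρ hρ), ?_, ?_, fun ρ hρ => ?_⟩
  · have heven : (fun ρ => f (-ρ)) =ᶠ[𝓝 0] f := by
      filter_upwards [(isOpen_lt continuous_abs continuous_const).mem_nhds h0r] with ρ hρ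
      exact (hprof (hexp p (ρ • E)) (-ρ) (hlt ρ hρ) (by rw [hcd, Real.cosh_neg])).symm
    have h1 := heven.deriv_eq
    rw [deriv_comp_neg, neg_zero] at h1
    linarith
  · rw [hf0, ← hv.eqn p hpS, laplaceBeltrami_eq_sum (hv.c2 p hpS)]
    simp only [hprof.hessQuad_center hS (hfC 0 h0r), frame_orthonormal]
    simp
  · have hρr : |ρ| < r := by rw [abs_of_pos hρ.1]; exact hρ.2
    set x := hexp p (ρ • E) with hx
    have hxS := hlt ρ hρr
    obtain ⟨G, hG, hev, hG1, hG2⟩ := hprof.exists_comp_coshDist hxS hρ.1 (hcd ρ).symm (hfC ρ hρr)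
    have h1 := hv.eqn x hxS
    have h2 : laplaceBeltrami v x = laplaceBeltrami (fun y => G (coshDist p y)) x := by
      rw [laplaceBeltrami_eq_sum (hv.c2 x hxS), laplaceBeltrami_eq_sum (isC2At_comp_coshDist hG)]
      exact Finset.sum_congr rfl fun i _ => (eventuallyEq_comp_hexp hev _).iteratedDeriv_eq 2
    rw [h2, laplaceBeltrami_comp_coshDist hG] at h1
    change _ = -μ * v x
    -- With s = cosh ρ, G''(s² - 1) + n s G' becomes f'' + (n - 1) coth ρ f', since f' = sinh ρ G'
    -- and f'' = sinh² ρ G'' + s G'.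
    rw [← h1, ← hG2, ← hG1, ← hx, hcd ρ]
    have hs := (Real.sinh_pos_iff.2 hρ.1).ne'
    have hC := Real.cosh_sq ρ
    rw [show Real.cosh ρ ^ 2 - 1 = Real.sinh ρ ^ 2 by linarith]
    field_simp
    ring

end IsDirichletSolution

/-- A function whose logarithm has a radial profile `k` with `k'' < k' < 0` is strictly
`1`-log-concave. -/
theorem strictlyLogConcaveOn_of_profile {p : Hyp n} {r : ℝ} (hr : 0 < r) {v : Hyp n → ℝ}
    {k : ℝ → ℝ} (hpos : ∀ x ∈ geodesicBall p r, 0 < v x)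
    (hk : HasRadialProfile p (Real.cosh r) (fun x => Real.log (v x)) k)
    (hkC : ∀ ρ ∈ Ico 0 r, ContDiffAt ℝ 2 k ρ) (h0 : deriv k 0 = 0) (h00 : deriv (deriv k) 0 < 0)
    (h : ∀ ρ ∈ Ioo 0 r, deriv k ρ < 0 ∧ deriv (deriv k) ρ < deriv k ρ) :
    StrictlyLogConcaveOn 1 v (geodesicBall p r) := by
  intro x hxB
  refine ⟨hpos x hxB, ?_⟩
  have hxS := (mem_geodesicBall_iff hr).1 hxB
  have hS : 1 < Real.cosh r := Real.one_lt_cosh.2 hr.ne'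
  rcases eq_or_ne x p with rfl | hne
  · have hC := hkC 0 ⟨le_rfl, hr⟩
    have hgrad : gradNorm (fun y => Real.log (v y)) x = 0 := by
      simp [gradNorm, hk.dirDeriv_center hS hC, h0]
    rw [hessMatrix_eq (p := x) (a := 0) (b := deriv (deriv k) 0)
      (fun X => by rw [hk.hessQuad_center hS hC]; ring)]
    exact posDef_of_rank_one (by rw [hgrad]; linarith) (by rw [hgrad]; linarith)
  · set ρ := hdist p x with hρ
    have hcosh : Real.cosh ρ = coshDist p x := cosh_hdist p x
    have hρ0 : 0 < ρ := Real.arcosh_pos (one_lt_coshDist hne)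
    have hρr : ρ < r := hxB
    have hσ : 0 < Real.sinh ρ := Real.sinh_pos_iff.2 hρ0
    have hσs := Real.sinh_lt_cosh ρ
    have hsum : ∑ i, mink p.1 (frame x i).1 ^ 2 = Real.sinh ρ ^ 2 := by
      rw [sum_mink_frame_sq, ← hcosh, Real.cosh_sq]; ring
    obtain ⟨hk1, hk2⟩ := h ρ ⟨hρ0, hρr⟩
    obtain ⟨G, hG, hev, hG1, hG2⟩ :=
      hk.exists_comp_coshDist hxS hρ0 hcosh (hkC ρ ⟨hρ0.le, hρr⟩)
    have hG0 : deriv G (coshDist p x) < 0 := by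
      by_contra hcon
      push Not at hcon
      nlinarith
    have hgrad : gradNorm (fun y => Real.log (v y)) x = -deriv k ρ := by
      have hd : ∀ i, dirDeriv (fun y => Real.log (v y)) x (frame x i) =
          -deriv G (coshDist p x) * mink p.1 (frame x i).1 := fun i => by
        rw [← dirDeriv_comp_coshDist hG]
        exact (eventuallyEq_comp_hexp hev _).deriv_eq
      simp only [gradNorm, hd, mul_pow, ← Finset.mul_sum, hsum]
      rw [← mul_pow, Real.sqrt_sq (by nlinarith), neg_mul, hG1]
    rw [hessMatrix_eq (p := p) (a := deriv (deriv G) (coshDist p x))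
      (b := deriv G (coshDist p x) * coshDist p x) (fun X => by
        rw [hessQuad, (eventuallyEq_comp_hexp hev X).iteratedDeriv_eq 2]
        refine (hessQuad_comp_coshDist hG X).trans ?_
        ring)]
    -- Tangentially, coth ρ k' - k' = G' (cosh ρ - sinh ρ) < 0; radially, k'' - k' < 0.
    refine posDef_of_rank_one ?_ ?_
    · rw [hgrad, ← hG1, ← hcosh]
      rw [← hcosh] at hG0
      nlinarith
    · rw [hgrad, hsum, hG2]
      linarith

end HypBall

theorem lemma2p1 (n : ℕ) (hn : 1 ≤ n) :
    ∃ r₀ : ℝ, 0 < r₀ ∧ ∀ (p : HypBall.Hyp n) (r : ℝ), 0 < r → r < r₀ →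
      ∀ v : HypBall.Hyp n → ℝ,
        HypBall.IsFirstEigenfunction (HypBall.geodesicBall p r) v →
          HypBall.StrictlyLogConcaveOn 1 v (HypBall.geodesicBall p r) := by
  -- The Riccati argument needs sinh r ≤ 1/2, which also gives the bound cosh r < 2 used for μ ≥ n;
  -- the radius is the same in all dimensions.
  refine ⟨Real.arsinh (1 / 2), Real.arsinh_pos_iff.2 (by norm_num), ?_⟩
  rintro p r hr hr₀ v ⟨μ, -, hv, hpos⟩
  have hsinh : Real.sinh r ≤ 1 / 2 := by
    have := Real.sinh_lt_sinh.2 hr₀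
    rw [Real.sinh_arsinh] at this
    exact this.le
  have hS : 1 < Real.cosh r := Real.one_lt_cosh.2 hr.ne'
  have hS2 : Real.cosh r < 2 := by
    have h1 := Real.cosh_sq r
    have h2 := Real.sinh_pos_iff.2 hr
    nlinarith
  have hsol := hv.isDirichletSolution hr
  have hpos' : ∀ x, HypBall.coshDist p x < Real.cosh r → 0 < v x := fun x hx =>
    hpos x ((HypBall.mem_geodesicBall_iff hr).2 hx)
  have hμ := hsol.le_eigenvalue hpos' hS hS2
  obtain ⟨f, hprof, hfC, hfpos, hf0, hf00, hode⟩ :=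
    hsol.exists_profile hn hr ((Nat.cast_nonneg n).trans hμ) hpos'
  obtain ⟨h0, h00, h⟩ := HypBall.log_profile hn hr hsinh hμ hfC hfpos hf0 hf00 hode
  have habs : ∀ ρ ∈ Set.Ico 0 r, |ρ| < r := fun ρ hρ => by
    rw [abs_of_nonneg hρ.1]; exact hρ.2
  exact HypBall.strictlyLogConcaveOn_of_profile hr hpos
    (fun x ρ hx hρ => congrArg Real.log (hprof x ρ hx hρ))
    (fun ρ hρ => (hfC ρ (habs ρ hρ)).log (hfpos ρ (habs ρ hρ)).ne') h0 h00 h
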